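/- Fix $a\in(0,1/2)$ and $b>1$, and let $G:[0,1)\to[0,1)$ be the Gauss map, $G(y)=1/y \bmod 1$ for $y\neq 0$ and $G(0)=0$. Write $\mathbb N=\{1,2,3,\dots\}$ and, for $y\in[0,1)$, $$\Lambda_y=\{n\in\mathbb N:\ G^n y\in(0,\,b^{n^{-a}}-1)\}.$$ (i) For Lebesgue-almost every $y\in[0,1)$ the set $\Lambda_y$ is infinite, and its increasing enumeration $(r_n)_{n\in\mathbb N}$ is pointwise universally $L^2$-good and ergodic. That is, for every probability space $(X,\mathcal X,\mu)$, every measure-preserving map $T:X\to X$ and every (complex-valued) $f\in L^2(\mu)$, the averages $$\frac1N\sum_{n=1}^N f(T^{r_n}x)$$ converge as $N\to\infty$ for $\mu$-almost every $x\in X$, and they converge in $L^2(\mu)$ to the conditional expectation $\mathbb E_\mu(f\mid\mathcal I(T))$, where $\mathcal I(T)=\{A\in\mathcal X:\ \mu(T^{-1}A\,\triangle\,A)=0\}$. The exceptional null set of $y$ does not depend on $(X,\mathcal X,\mu,T)$ or $f$. (ii) Let $\nu$ be the Gauss measure on $[0,1)$, $d\nu=\frac{dx}{\ln 2\,(1+x)}$.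 For every $n\in\mathbb N$ with $b^{n^{-a}}\le 2$, and hence for all sufficiently large $n$, $\nu\big((0,b^{n^{-a}}-1)\big)=\frac{\ln b}{\ln 2}\,n^{-a}$. -/

import Mathlib

open MeasureTheory Filter Topology

universe u

/-- The `σ`-algebra `𝓘(T)` of the measurable sets `A` with `T⁻¹ A = A` modulo `μ`. -/
@[reducible]
def invariantsMod {X : Type*} [m : MeasurableSpace X] (T : X → X) (μ : Measure X) :
    MeasurableSpace X where
  MeasurableSet' A := MeasurableSet[m] A ∧ T ⁻¹' A =ᵐ[μ] A
  measurableSet_empty := ⟨MeasurableSet.empty, by simp⟩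
  measurableSet_compl A hA := ⟨hA.1.compl, by
    rw [Set.preimage_compl]
    exact hA.2.compl⟩
  measurableSet_iUnion A hA := ⟨MeasurableSet.iUnion fun i => (hA i).1, by
    rw [Set.preimage_iUnion]
    exact Filter.EventuallyEq.countable_iUnion fun i => (hA i).2⟩

/-- The ergodic average of `f` along the first `N` terms of the sequence `r`, at the point `x`.
The sequence is indexed from `0`, so its first `N` terms are `r 0, …, r (N - 1)`. -/
noncomputable def ergodicAverage {X : Type*} (T : X → X) (r : ℕ → ℕ) (f : X → ℂ) (N : ℕ) (x : X) :
    ℂ :=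
  (N : ℂ)⁻¹ * ∑ n ∈ Finset.range N, f (T^[r n] x)

/-- The sequence `r` is pointwise universally `L^p`-good: for every measure-preserving system
`(X, μ, T)` on a probability space and every `f ∈ L^p(μ)`, the ergodic averages of `f` along `r`
converge `μ`-almost everywhere. -/
def PointwiseUniversallyGood (p : ENNReal) (r : ℕ → ℕ) : Prop :=
  ∀ (X : Type u) [MeasurableSpace X] (μ : Measure X) [IsProbabilityMeasure μ] (T : X → X),
    MeasurePreserving T μ μ → ∀ f : X → ℂ, MemLp f p μ →
      ∀ᵐ x ∂μ, ∃ l : ℂ, Tendsto (fun N : ℕ => ergodicAverage T r f N x) atTop (𝓝 l)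

/-- The sequence `r` is ergodic: for every measure-preserving system `(X, μ, T)` on a probability
space and every `f ∈ L²(μ)`, the ergodic averages of `f` along `r` converge in `L²(μ)` to the
conditional expectation of `f` given `𝓘(T)`. -/
def IsErgodicSequence (r : ℕ → ℕ) : Prop :=
  ∀ (X : Type u) [MeasurableSpace X] (μ : Measure X) [IsProbabilityMeasure μ] (T : X → X),
    MeasurePreserving T μ μ → ∀ f : X → ℂ, MemLp f 2 μ →
      Tendsto (fun N : ℕ => eLpNorm (ergodicAverage T r f N - μ[f | invariantsMod T μ]) 2 μ)
        atTop (𝓝 0)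

/-- The Gauss map `G(y) = 1/y mod 1` for `y ≠ 0`, `G(0) = 0`; it maps `[0,1)` to `[0,1)`. -/
noncomputable def gaussMap (y : ℝ) : ℝ := if y = 0 then 0 else Int.fract (1 / y)

/-- The Gauss measure on `[0,1)`, with density `1 / (log 2 · (1 + x))`. -/
noncomputable def gaussMeasure : Measure ℝ :=
  (volume.restrict (Set.Ico (0 : ℝ) 1)).withDensity
    fun x => ENNReal.ofReal (1 / (Real.log 2 * (1 + x)))

/-- The set of positive integers `n` with `G^n y ∈ (0, b^(n^(-a)) - 1)`. -/
noncomputable def gaussReturnTimes (a b y : ℝ) : Set ℕ :=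
  {n : ℕ | 1 ≤ n ∧ gaussMap^[n] y ∈ Set.Ioo (0 : ℝ) (b ^ ((n : ℝ) ^ (-a)) - 1)}

/-! Write `σ n` for the Gauss measure of the `n`-th target, `W N` for its partial sums, `Λ` for the
set of return times and `c = 1_Λ - σ`. Averages weighted by `σ` converge almost everywhere by
Birkhoff's theorem and Abel summation, so it suffices that `∑_{n<N} c n · f(T^n x)` is `o(W N)`.
Since `∫ f∘T^n · f∘T^(n+h)` does not depend on `n` and is at most `∫ f²` in modulus, the second
moment of that sum is at most `2 ∫ f²` times the sum over lags of the absolute autocorrelations of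
`c` (`integral_sq_sum_comp_iterate_le`). The second factor depends on `y` only, which is why one
null set serves all systems and functions.

For random `y` the autocorrelations are small in mean. The transfer operator of the Gauss map sends
monotone functions to antitone ones and halves their oscillation; indicators of intervals `(0, t)`
are, up to sign and a constant, monotone, so centred hits decorrelate exponentially against
arbitrary bounded functions of the future (`abs_integral_mul_comp_gaussMap_sub_le`). Fourth-order
mixed moments then bound the variance of every autocorrelation at lag at least `L`, while shorter
lags are bounded trivially (`integral_autocorrelationSum_le`).

With `x = N^(1/2-a)` one has `W ≥ c √N x` and `∑ σ² ≤ C x²`, so the expected autocorrelation sum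
over `W²` is `O(L / x)`. As `a < 1/2`, this is summable along `N k = (k+2)^p` with `L = k+2` and `p`
large. Almost every `y` therefore satisfies `HasRegularDensity`. The gaps between the `N k` are
filled by monotonicity for `f ≥ 0`, because `W (N (k+1)) / W (N k) → 1`. Taking `f = 1` shows that
`W` counts `Λ` asymptotically, so `W` may be replaced by the number of return times. Mean
convergence follows by approximation with bounded functions. -/

/-! ### Birkhoff's ergodic theorem -/

section Birkhoff

variable {X : Type*} {T : X → X}

/-- The running maximum `max (0, φ, φ + φ ∘ T, …)` of the first `N` Birkhoff sums. -/
def birkhoffMax (T : X → X) (φ : X → ℝ) : ℕ → X → ℝ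
  | 0, _ => 0
  | N + 1, x => max 0 (φ x + birkhoffMax T φ N (T x))

lemma birkhoffMax_nonneg (φ : X → ℝ) (N : ℕ) (x : X) : 0 ≤ birkhoffMax T φ N x := by
  cases N with
  | zero => exact le_rfl
  | succ N => exact le_max_left _ _

lemma birkhoffMax_le_succ (φ : X → ℝ) (N : ℕ) (x : X) :
    birkhoffMax T φ N x ≤ birkhoffMax T φ (N + 1) x := by
  induction N generalizing x with
  | zero => exact le_max_left _ _
  | succ N ih => exact max_le_max le_rfl (by linarith [ih (T x)])

lemma birkhoffSum_le_birkhoffMax (φ : X → ℝ) (N : ℕ) (x : X) :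
    birkhoffSum T φ N x ≤ birkhoffMax T φ N x := by
  induction N generalizing x with
  | zero => simp [birkhoffMax]
  | succ N ih =>
    rw [birkhoffSum_succ']
    exact le_max_of_le_right (by linarith [ih (T x)])

lemma exists_birkhoffSum_eq_birkhoffMax (φ : X → ℝ) (N : ℕ) (x : X) :
    ∃ n, birkhoffMax T φ N x = birkhoffSum T φ n x := by
  induction N generalizing x with
  | zero => exact ⟨0, by simp [birkhoffMax]⟩
  | succ N ih =>
    obtain ⟨n, hn⟩ := ih (T x)
    rcases max_choice 0 (φ x + birkhoffMax T φ N (T x)) with h | h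
    · exact ⟨0, by simpa [birkhoffMax] using h⟩
    · exact ⟨n + 1, by rw [birkhoffSum_succ', ← hn]; exact h⟩

lemma exists_birkhoffMax_pos_iff (φ : X → ℝ) (x : X) :
    (∃ N, 0 < birkhoffMax T φ N x) ↔ ∃ n, 0 < birkhoffSum T φ n x := by
  constructor
  · rintro ⟨N, hN⟩
    obtain ⟨n, hn⟩ := exists_birkhoffSum_eq_birkhoffMax (T := T) φ N x
    exact ⟨n, hn ▸ hN⟩
  · rintro ⟨n, hn⟩
    exact ⟨n, hn.trans_le (birkhoffSum_le_birkhoffMax φ n x)⟩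

variable [MeasurableSpace X] {μ : Measure X}

lemma invariantsMod_le (T : X → X) (μ : Measure X) :
    invariantsMod T μ ≤ (inferInstance : MeasurableSpace X) := fun _ h => h.1

lemma measurable_birkhoffMax (hT : Measurable T) {φ : X → ℝ} (hφ : Measurable φ) (N : ℕ) :
    Measurable (birkhoffMax T φ N) := by
  induction N with
  | zero => exact measurable_const
  | succ N ih => exact measurable_const.max (hφ.add (ih.comp hT))

lemma integrable_birkhoffMax [IsFiniteMeasure μ] (hT : MeasurePreserving T μ μ) {φ : X → ℝ}
    (hφ : Integrable φ μ) (N : ℕ) : Integrable (birkhoffMax T φ N) μ := by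
  induction N with
  | zero => exact integrable_const 0
  | succ N ih =>
    have h := (integrable_const (0 : ℝ)).sup (hφ.add (hT.integrable_comp_of_integrable ih))
    exact h

/-- Garsia's argument: where `M > 0`, the recursion gives `M ≤ φ + M ∘ T`. Integrating `M - M ∘ T`
over that set gives at least `∫ M - ∫ M ∘ T = 0`, because `M` vanishes off the set and `M ∘ T ≥ 0`.
-/
lemma setIntegral_birkhoffMax_pos_nonneg [IsFiniteMeasure μ] (hT : MeasurePreserving T μ μ)
    {φ : X → ℝ} (hφm : Measurable φ) (hφ : Integrable φ μ) (N : ℕ) :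
    0 ≤ ∫ x in {x | 0 < birkhoffMax T φ N x}, φ x ∂μ := by
  cases N with
  | zero => simp [birkhoffMax]
  | succ N =>
    set M := birkhoffMax T φ (N + 1) with hM
    have hMm : Measurable M := measurable_birkhoffMax hT.measurable hφm _
    have hMi : Integrable M μ := integrable_birkhoffMax hT hφ _
    have hMTi : Integrable (fun x => M (T x)) μ := hT.integrable_comp_of_integrable hMi
    have hA : MeasurableSet {x | 0 < M x} := measurableSet_lt measurable_const hMm
    have h1 : ∫ x in {x | 0 < M x}, (M x - M (T x)) ∂μ ≤ ∫ x in {x | 0 < M x}, φ x ∂μ := by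
      refine setIntegral_mono_on (hMi.sub hMTi).integrableOn hφ.integrableOn hA fun x hx => ?_
      have h2 : M x = max 0 (φ x + birkhoffMax T φ N (T x)) := rfl
      have h3 := birkhoffMax_le_succ (T := T) φ N (T x)
      have h4 : M x = φ x + birkhoffMax T φ N (T x) := by
        rcases max_choice 0 (φ x + birkhoffMax T φ N (T x)) with h | h
        · have : 0 < M x := hx
          rw [h2, h] at this
          exact absurd this (lt_irrefl _)
        · rw [h2, h]
      rw [← hM] at h3
      linarith
    refine le_trans ?_ h1
    rw [integral_sub hMi.integrableOn hMTi.integrableOn]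
    have h5 : ∫ x in {x | 0 < M x}, M x ∂μ = ∫ x, M x ∂μ := by
      refine setIntegral_eq_integral_of_forall_compl_eq_zero fun x hx => ?_
      exact le_antisymm (not_lt.1 hx) (birkhoffMax_nonneg φ _ x)
    have h6 : ∫ x in {x | 0 < M x}, M (T x) ∂μ ≤ ∫ x, M (T x) ∂μ :=
      setIntegral_le_integral hMTi (ae_of_all _ fun x => birkhoffMax_nonneg φ _ _)
    have h7 : ∫ x, M (T x) ∂μ = ∫ x, M x ∂μ := by
      rw [← integral_map (μ := μ) hT.measurable.aemeasurable (f := M)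
        (by rw [hT.map_eq]; exact hMi.1), hT.map_eq]
    linarith

/-- The maximal ergodic theorem. -/
theorem setIntegral_exists_birkhoffSum_pos_nonneg [IsFiniteMeasure μ]
    (hT : MeasurePreserving T μ μ) {φ : X → ℝ} (hφm : Measurable φ) (hφ : Integrable φ μ) :
    0 ≤ ∫ x in {x | ∃ n, 0 < birkhoffSum T φ n x}, φ x ∂μ := by
  have hset : {x | ∃ n, 0 < birkhoffSum T φ n x} = ⋃ N, {x | 0 < birkhoffMax T φ N x} := by
    ext x
    simp only [Set.mem_ofPred_eq, Set.mem_iUnion]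
    exact (exists_birkhoffMax_pos_iff φ x).symm
  rw [hset]
  refine ge_of_tendsto' (tendsto_setIntegral_of_monotone
    (fun N => measurableSet_lt measurable_const (measurable_birkhoffMax hT.measurable hφm N))
    (monotone_nat_of_le_succ fun N x hx => ?_) hφ.integrableOn)
    fun N => setIntegral_birkhoffMax_pos_nonneg hT hφm hφ N
  exact lt_of_lt_of_le hx (birkhoffMax_le_succ φ N x)

/-- The countably many rational sublevel sets are invariant modulo `μ`, and they determine the
values of `g`. -/
lemma comp_ae_eq_of_stronglyMeasurable_invariantsMod {g : X → ℝ}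
    (hg : StronglyMeasurable[invariantsMod T μ] g) : ∀ᵐ x ∂μ, g (T x) = g x := by
  have h : ∀ q : ℚ, T ⁻¹' {x | g x < q} =ᵐ[μ] {x | g x < q} := fun q =>
    (hg.measurable measurableSet_Iio : MeasurableSet[invariantsMod T μ] (g ⁻¹' Set.Iio (q : ℝ))).2
  filter_upwards [ae_all_iff.2 fun q => (h q).mem_iff] with x hx
  refine le_antisymm ?_ ?_ <;> refine le_of_forall_gt fun c hc => ?_
  · obtain ⟨q, hq, hq'⟩ := exists_rat_btwn hc
    exact lt_trans ((hx q).2 hq) hq'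
  · obtain ⟨q, hq, hq'⟩ := exists_rat_btwn hc
    exact lt_trans ((hx q).1 hq) hq'

lemma ae_forall_iterate {p : X → Prop} (hT : MeasurePreserving T μ μ) (h : ∀ᵐ x ∂μ, p x) :
    ∀ᵐ x ∂μ, ∀ n, p (T^[n] x) :=
  ae_all_iff.2 fun n => (hT.iterate n).quasiMeasurePreserving.ae h

lemma ae_comp_iterate_eq_condExp (hT : MeasurePreserving T μ μ) (f : X → ℝ) :
    ∀ᵐ x ∂μ, ∀ n, (μ[f | invariantsMod T μ]) (T^[n] x) = (μ[f | invariantsMod T μ]) x := by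
  have h0 : StronglyMeasurable[invariantsMod T μ] (μ[f | invariantsMod T μ]) :=
    stronglyMeasurable_condExp
  have h := ae_forall_iterate hT (comp_ae_eq_of_stronglyMeasurable_invariantsMod h0)
  filter_upwards [h] with x hx n
  induction n with
  | zero => rfl
  | succ n ih => rw [Function.iterate_succ_apply', hx n, ih]

/-- The set `A` of unbounded orbits is strictly invariant. The maximal ergodic theorem for `1_A φ`
gives `0 ≤ ∫_A φ`, while `f` and its conditional expectation have equal integrals over `A`, so that
`∫_A φ = -ε μ(A)`. Hence `μ(A) = 0`. -/
lemma ae_bddAbove_birkhoffSum [IsFiniteMeasure μ] (hT : MeasurePreserving T μ μ) {f : X → ℝ}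
    (hfm : Measurable f) (hf : Integrable f μ) {ε : ℝ} (hε : 0 < ε) :
    ∀ᵐ x ∂μ, BddAbove (Set.range fun n =>
      birkhoffSum T (fun x => f x - (μ[f | invariantsMod T μ]) x - ε) n x) := by
  set E := μ[f | invariantsMod T μ] with hE
  set φ : X → ℝ := fun x => f x - E x - ε with hφ
  have hEm : Measurable E := (stronglyMeasurable_condExp.mono (invariantsMod_le T μ)).measurable
  have hφm : Measurable φ := (hfm.sub hEm).sub_const ε
  have hEi : Integrable E μ := integrable_condExp
  have hφi : Integrable φ μ := (hf.sub hEi).sub (integrable_const ε)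
  set A : Set X := {x | ¬ BddAbove (Set.range fun n => birkhoffSum T φ n x)} with hA
  have hAchar : A = ⋂ C : ℕ, ⋃ n : ℕ, {x | (C : ℝ) < birkhoffSum T φ n x} := by
    ext x
    simp only [hA, Set.mem_ofPred_eq, Set.mem_iInter, Set.mem_iUnion, not_bddAbove_iff,
      Set.exists_range_iff]
    refine ⟨fun h C => h C, fun h c => ?_⟩
    obtain ⟨C, hC⟩ := exists_nat_ge c
    obtain ⟨n, hn⟩ := h C
    exact ⟨n, hC.trans_lt hn⟩
  have hSm : ∀ n, Measurable (birkhoffSum T φ n) := fun n => by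
    unfold birkhoffSum
    exact Finset.measurable_sum _ fun k _ => hφm.comp (hT.measurable.iterate k)
  have hAm : MeasurableSet A := by
    rw [hAchar]
    exact MeasurableSet.iInter fun C => MeasurableSet.iUnion fun n =>
      measurableSet_lt measurable_const (hSm n)
  have hAT : ∀ x, T x ∈ A ↔ x ∈ A := by
    intro x
    refine not_congr ⟨?_, ?_⟩
    · rintro ⟨C, hC⟩
      refine ⟨max 0 (φ x + C), ?_⟩
      rintro _ ⟨n, rfl⟩
      cases n with
      | zero => simp
      | succ n =>
        have := hC ⟨n, rfl⟩
        simp only [birkhoffSum_succ']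
        exact le_max_of_le_right (by linarith)
    · rintro ⟨C, hC⟩
      refine ⟨C - φ x, ?_⟩
      rintro _ ⟨n, rfl⟩
      have := hC ⟨n + 1, rfl⟩
      simp only [birkhoffSum_succ'] at this
      simp only
      linarith
  have hATn : ∀ n x, T^[n] x ∈ A ↔ x ∈ A := by
    intro n x
    induction n with
    | zero => rfl
    | succ n ih => rw [Function.iterate_succ_apply', hAT, ih]
  have hsum : ∀ n x, birkhoffSum T (A.indicator φ) n x = A.indicator (birkhoffSum T φ n) x := by
    intro n x
    by_cases hx : x ∈ A
    · rw [Set.indicator_of_mem hx]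
      exact Finset.sum_congr rfl fun k _ => Set.indicator_of_mem ((hATn k x).2 hx) _
    · rw [Set.indicator_of_notMem hx]
      exact Finset.sum_eq_zero fun k _ => Set.indicator_of_notMem (fun h => hx ((hATn k x).1 h)) _
  have hpos : {x | ∃ n, 0 < birkhoffSum T (A.indicator φ) n x} = A := by
    ext x
    simp only [Set.mem_ofPred_eq, hsum]
    refine ⟨fun ⟨n, hn⟩ => ?_, fun hx => ?_⟩
    · by_contra hx
      rw [Set.indicator_of_notMem hx] at hn
      exact lt_irrefl _ hn
    · have h0 := hx
      rw [hAchar] at h0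
      obtain ⟨n, hn⟩ := Set.mem_iUnion.1 (Set.mem_iInter.1 h0 0)
      exact ⟨n, by rw [Set.indicator_of_mem hx]; simpa using hn⟩
  have h0 := setIntegral_exists_birkhoffSum_pos_nonneg hT (hφm.indicator hAm)
    (hφi.indicator hAm)
  rw [hpos, setIntegral_indicator hAm, Set.inter_self] at h0
  have hAinv : MeasurableSet[invariantsMod T μ] A :=
    ⟨hAm, by
      have : T ⁻¹' A = A := Set.ext hAT
      rw [this]; exact EventuallyEq.rfl⟩
  have h1 : ∫ x in A, φ x ∂μ = - (ε * μ.real A) := by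
    have h2 : ∫ x in A, φ x ∂μ = ∫ x in A, (f x - E x) ∂μ - ∫ _ in A, ε ∂μ :=
      integral_sub (hf.sub hEi).integrableOn (integrable_const ε).integrableOn
    rw [h2, integral_sub hf.integrableOn hEi.integrableOn, hE,
      setIntegral_condExp (invariantsMod_le T μ) hf hAinv]
    simp [mul_comm]
  have h2 : μ.real A = 0 := by
    have := measureReal_nonneg (μ := μ) (s := A)
    nlinarith
  have h3 : μ A = 0 := by
    rwa [Measure.real, ENNReal.toReal_eq_zero_iff, or_iff_left (measure_ne_top μ A)] at h2
  rw [ae_iff]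
  exact h3

lemma ae_eventually_birkhoff_le [IsFiniteMeasure μ] (hT : MeasurePreserving T μ μ) {f : X → ℝ}
    (hfm : Measurable f) (hf : Integrable f μ) :
    ∀ᵐ x ∂μ, ∀ ε > 0, ∀ᶠ N : ℕ in atTop,
      (N : ℝ)⁻¹ * ∑ n ∈ Finset.range N, f (T^[n] x) ≤ (μ[f | invariantsMod T μ]) x + ε := by
  -- Countably many `ε` give a single null set. Bounded sums of `f - E - ε/2`, with `E` constant
  -- along orbits, make the average at most `E + ε/2 + C/N`.
  have h := ae_all_iff.2 fun j : ℕ => ae_bddAbove_birkhoffSum hT hfm hf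
    (ε := 1 / ((j : ℝ) + 1)) (by positivity)
  filter_upwards [h, ae_comp_iterate_eq_condExp hT f] with x hx hE ε hε
  obtain ⟨j, hj⟩ := exists_nat_one_div_lt (half_pos hε)
  obtain ⟨C, hC⟩ := hx j
  have hlim : Tendsto (fun N : ℕ => C / (N : ℝ)) atTop (𝓝 0) := tendsto_const_div_atTop_nhds_zero_nat C
  filter_upwards [hlim.eventually_lt_const (half_pos hε), eventually_gt_atTop 0] with N hN hN0
  have h1 := hC ⟨N, rfl⟩
  simp only [birkhoffSum, hE, Finset.sum_sub_distrib, Finset.sum_const, Finset.card_range,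
    nsmul_eq_mul] at h1
  have hN' : (0 : ℝ) < N := by exact_mod_cast hN0
  rw [inv_mul_le_iff₀ hN']
  rw [div_lt_iff₀ hN'] at hN
  nlinarith

/-- Birkhoff's pointwise ergodic theorem. -/
theorem ae_tendsto_birkhoff [IsFiniteMeasure μ] (hT : MeasurePreserving T μ μ) {f : X → ℝ}
    (hf : Integrable f μ) :
    ∀ᵐ x ∂μ, Tendsto (fun N : ℕ => (N : ℝ)⁻¹ * ∑ n ∈ Finset.range N, f (T^[n] x)) atTop
      (𝓝 ((μ[f | invariantsMod T μ]) x)) := by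
  set g := hf.1.aemeasurable.mk f with hg
  have hfg : f =ᵐ[μ] g := hf.1.aemeasurable.ae_eq_mk
  have hgm : Measurable g := hf.1.aemeasurable.measurable_mk
  have hgi : Integrable g μ := hf.congr hfg
  -- The lower bound is the upper bound for `-g`.
  filter_upwards [ae_eventually_birkhoff_le hT hgm hgi, ae_eventually_birkhoff_le hT hgm.neg hgi.neg,
    condExp_neg g (invariantsMod T μ) (μ := μ), ae_forall_iterate hT hfg,
    condExp_congr_ae hfg (m := invariantsMod T μ)] with x h1 h2 h3 h4 h5
  simp only [h4, h5]
  rw [h3] at h2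
  refine Metric.tendsto_atTop.2 fun ε hε => ?_
  refine eventually_atTop.1 ?_
  filter_upwards [h1 _ (half_pos hε), h2 _ (half_pos hε)] with N hN1 hN2
  simp only [Pi.neg_apply, Finset.sum_neg_distrib, mul_neg] at hN2
  rw [Real.dist_eq, abs_lt]
  constructor <;> linarith

end Birkhoff

/-! ### Weighted averages, subsequences and enumeration -/

section Sequences

/-- The sum of the absolute values of the autocorrelations of `c 0, …, c (N - 1)`. -/
noncomputable def autocorrelationSum (c : ℕ → ℝ) (N : ℕ) : ℝ :=
  ∑ h ∈ Finset.range N, |∑ n ∈ Finset.range (N - h), c n * c (n + h)|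

lemma autocorrelationSum_nonneg (c : ℕ → ℝ) (N : ℕ) : 0 ≤ autocorrelationSum c N :=
  Finset.sum_nonneg fun _ _ => abs_nonneg _

/-- Pairs of indices are grouped by their distance `h`; off the diagonal each pair occurs in two
orders. -/
lemma sq_sum_range_eq_sum_shift (a : ℕ → ℝ) (N : ℕ) :
    (∑ n ∈ Finset.range N, a n) ^ 2 = ∑ h ∈ Finset.range N,
      (if h = 0 then 1 else 2) * ∑ n ∈ Finset.range (N - h), a n * a (n + h) := by
  induction N with
  | zero => simp
  | succ N ih =>
    have h1 : ∀ h ∈ Finset.range (N + 1),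
        (if h = 0 then (1 : ℝ) else 2) * ∑ n ∈ Finset.range (N + 1 - h), a n * a (n + h) =
        (if h = 0 then (1 : ℝ) else 2) * ∑ n ∈ Finset.range (N - h), a n * a (n + h) +
        (if h = 0 then (1 : ℝ) else 2) * (a (N - h) * a N) := by
      intro h hh
      have hle : h ≤ N := Nat.lt_succ_iff.1 (Finset.mem_range.1 hh)
      rw [Nat.sub_add_comm hle, Finset.sum_range_succ, Nat.sub_add_cancel hle, mul_add]
    rw [Finset.sum_congr rfl h1, Finset.sum_add_distrib, Finset.sum_range_succ (fun h =>
        (if h = 0 then (1 : ℝ) else 2) * ∑ n ∈ Finset.range (N - h), a n * a (n + h)),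
      Nat.sub_self, Finset.sum_range_zero, mul_zero, add_zero, ← ih, Finset.sum_range_succ' (fun h =>
        (if h = 0 then (1 : ℝ) else 2) * (a (N - h) * a N))]
    simp only [Nat.add_eq_zero_iff, one_ne_zero, and_false, if_false, if_true, Nat.sub_zero,
      one_mul]
    have h2 : ∑ k ∈ Finset.range N, 2 * (a (N - (k + 1)) * a N) =
        2 * a N * ∑ n ∈ Finset.range N, a n := by
      rw [← Finset.sum_range_reflect a N, Finset.mul_sum]
      refine Finset.sum_congr rfl fun k _ => ?_
      rw [show N - 1 - k = N - (k + 1) by omega]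
      ring
    rw [h2, Finset.sum_range_succ]
    ring

lemma abs_weighted_sum_le {σ v : ℕ → ℝ} (hσ : Antitone σ) (hσ0 : ∀ n, 0 ≤ σ n) {ε K : ℝ}
    (hv : ∀ N : ℕ, |∑ n ∈ Finset.range N, v n| ≤ ε * N + K) (N : ℕ) :
    |∑ n ∈ Finset.range N, σ n * v n| ≤ ε * ∑ n ∈ Finset.range N, σ n + K * σ 0 := by
  -- Abel summation: without its boundary term the weighted sum grows by `(σ N - σ (N+1))` times a
  -- partial sum of `v`, and the increments of the bound telescope.
  have key : ∀ N : ℕ, |∑ n ∈ Finset.range N, σ n * v n - σ N * ∑ n ∈ Finset.range N, v n| ≤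
      ε * (∑ n ∈ Finset.range N, σ n - N * σ N) + K * (σ 0 - σ N) := by
    intro N
    induction N with
    | zero => simp
    | succ N ih =>
      have h1 : ∑ n ∈ Finset.range (N + 1), σ n * v n -
          σ (N + 1) * ∑ n ∈ Finset.range (N + 1), v n =
          (∑ n ∈ Finset.range N, σ n * v n - σ N * ∑ n ∈ Finset.range N, v n) +
          (σ N - σ (N + 1)) * ∑ n ∈ Finset.range (N + 1), v n := by
        simp only [Finset.sum_range_succ]
        ring
      have h2 : 0 ≤ σ N - σ (N + 1) := sub_nonneg.2 (hσ N.le_succ)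
      rw [h1]
      refine (abs_add_le _ _).trans ?_
      rw [abs_mul, abs_of_nonneg h2]
      have h3 := mul_le_mul_of_nonneg_left (hv (N + 1)) h2
      rw [Finset.sum_range_succ σ]
      push_cast at h3 ⊢
      linarith
  have h1 := key N
  have h2 := mul_le_mul_of_nonneg_left (hv N) (hσ0 N)
  have h3 := abs_add_le (∑ n ∈ Finset.range N, σ n * v n - σ N * ∑ n ∈ Finset.range N, v n)
    (σ N * ∑ n ∈ Finset.range N, v n)
  rw [sub_add_cancel, abs_mul, abs_of_nonneg (hσ0 N)] at h3
  linarith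

lemma exists_abs_sum_le_of_tendsto_cesaro {v : ℕ → ℝ}
    (hv : Tendsto (fun N : ℕ => (N : ℝ)⁻¹ * ∑ n ∈ Finset.range N, v n) atTop (𝓝 0)) {ε : ℝ}
    (hε : 0 < ε) : ∃ K, 0 ≤ K ∧ ∀ N : ℕ, |∑ n ∈ Finset.range N, v n| ≤ ε * N + K := by
  obtain ⟨N₀, hN₀⟩ := Metric.tendsto_atTop.1 hv ε hε
  refine ⟨∑ n ∈ Finset.range N₀, |v n|, Finset.sum_nonneg fun _ _ => abs_nonneg _, fun N => ?_⟩
  have hK : 0 ≤ ∑ n ∈ Finset.range N₀, |v n| := Finset.sum_nonneg fun _ _ => abs_nonneg _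
  rcases le_total N₀ N with h | h
  · rcases Nat.eq_zero_or_pos N with rfl | hN
    · simpa using hK
    · have h1 := hN₀ N h
      have hN' : (0 : ℝ) < N := by exact_mod_cast hN
      rw [Real.dist_eq, sub_zero, abs_mul, abs_inv, abs_of_pos hN', inv_mul_lt_iff₀ hN'] at h1
      linarith
  · have h1 : |∑ n ∈ Finset.range N, v n| ≤ ∑ n ∈ Finset.range N₀, |v n| :=
      (Finset.abs_sum_le_sum_abs _ _).trans
        (Finset.sum_le_sum_of_subset_of_nonneg (Finset.range_mono h) fun _ _ _ => abs_nonneg _)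
    have : 0 ≤ ε * N := by positivity
    linarith

lemma tendsto_weighted_of_tendsto_cesaro {σ u : ℕ → ℝ} {l : ℝ} (hσ : Antitone σ)
    (hσ0 : ∀ n, 0 ≤ σ n)
    (hW : Tendsto (fun N : ℕ => ∑ n ∈ Finset.range N, σ n) atTop atTop)
    (hu : Tendsto (fun N : ℕ => (N : ℝ)⁻¹ * ∑ n ∈ Finset.range N, u n) atTop (𝓝 l)) :
    Tendsto (fun N : ℕ => (∑ n ∈ Finset.range N, σ n * u n) / ∑ n ∈ Finset.range N, σ n)
      atTop (𝓝 l) := by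
  have hv : Tendsto (fun N : ℕ => (N : ℝ)⁻¹ * ∑ n ∈ Finset.range N, (u n - l)) atTop (𝓝 0) := by
    rw [← sub_self l]
    refine (hu.sub_const l).congr' ?_
    filter_upwards [eventually_gt_atTop 0] with N hN
    have hN' : (N : ℝ) ≠ 0 := by positivity
    rw [Finset.sum_sub_distrib, Finset.sum_const, Finset.card_range, nsmul_eq_mul]
    field_simp
  refine Metric.tendsto_atTop.2 fun ε hε => ?_
  obtain ⟨K, hK, hKN⟩ := exists_abs_sum_le_of_tendsto_cesaro hv (half_pos hε)
  refine eventually_atTop.1 ?_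
  filter_upwards [hW.eventually_gt_atTop (K * σ 0 / (ε / 2)), hW.eventually_gt_atTop 0]
    with N hN hN0
  have h1 := abs_weighted_sum_le hσ hσ0 hKN N
  rw [div_lt_iff₀ (half_pos hε)] at hN
  have h2 : ∑ n ∈ Finset.range N, σ n * (u n - l) =
      ∑ n ∈ Finset.range N, σ n * u n - l * ∑ n ∈ Finset.range N, σ n := by
    rw [Finset.mul_sum, ← Finset.sum_sub_distrib]
    exact Finset.sum_congr rfl fun n _ => by ring
  rw [h2] at h1
  rw [Real.dist_eq, div_sub' hN0.ne', abs_div, abs_of_pos hN0, div_lt_iff₀ hN0, mul_comm _ l]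
  linarith

lemma tendsto_cesaro_succ {u : ℕ → ℝ} {l : ℝ}
    (hu : Tendsto (fun N : ℕ => (N : ℝ)⁻¹ * ∑ n ∈ Finset.range N, u n) atTop (𝓝 l)) :
    Tendsto (fun N : ℕ => (N : ℝ)⁻¹ * ∑ n ∈ Finset.range N, u (n + 1)) atTop (𝓝 l) := by
  have h1 : Tendsto (fun N : ℕ => ((N : ℝ) + 1) / N) atTop (𝓝 1) := by
    have : Tendsto (fun N : ℕ => 1 + 1 / (N : ℝ)) atTop (𝓝 (1 + 0)) :=
      tendsto_const_nhds.add tendsto_one_div_atTop_nhds_zero_nat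
    rw [add_zero] at this
    refine this.congr' ?_
    filter_upwards [eventually_gt_atTop 0] with N hN
    have hN' : (N : ℝ) ≠ 0 := by positivity
    field_simp
  have h2 : Tendsto (fun N : ℕ => u 0 / (N : ℝ)) atTop (𝓝 0) := tendsto_const_div_atTop_nhds_zero_nat _
  have h3 := (h1.mul (hu.comp (tendsto_add_atTop_nat 1))).sub h2
  rw [one_mul, sub_zero] at h3
  refine h3.congr' ?_
  filter_upwards [eventually_gt_atTop 0] with N hN
  have hN' : (N : ℝ) ≠ 0 := by positivity
  simp only [Function.comp, Finset.sum_range_succ' u N]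
  push_cast
  field_simp
  ring

/-- The densities used later vanish at `0`, since `(0 : ℝ) ^ (-a) = 0`, and are antitone only from
`1` on; a shift by one repairs this. -/
lemma tendsto_weighted_of_tendsto_cesaro_of_zero {σ u : ℕ → ℝ} {l : ℝ} (hσz : σ 0 = 0)
    (hσ : Antitone fun n => σ (n + 1)) (hσ0 : ∀ n, 0 ≤ σ n)
    (hW : Tendsto (fun N : ℕ => ∑ n ∈ Finset.range N, σ n) atTop atTop)
    (hu : Tendsto (fun N : ℕ => (N : ℝ)⁻¹ * ∑ n ∈ Finset.range N, u n) atTop (𝓝 l)) :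
    Tendsto (fun N : ℕ => (∑ n ∈ Finset.range N, σ n * u n) / ∑ n ∈ Finset.range N, σ n)
      atTop (𝓝 l) := by
  rw [← tendsto_add_atTop_iff_nat 1] at hW ⊢
  simp only [Finset.sum_range_succ', hσz, zero_mul, add_zero] at hW ⊢
  exact tendsto_weighted_of_tendsto_cesaro hσ (fun n => hσ0 _) hW (tendsto_cesaro_succ hu)

/-- For `N k ≤ n < N (k+1)` the quotient lies between `S (N k) / W (N (k+1))` and `S (N (k+1)) / W
(N k)`, and both tend to `l`. -/
lemma tendsto_div_of_tendsto_subseq {S W : ℕ → ℝ} {N : ℕ → ℕ} {l : ℝ} (hS : Monotone S)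
    (hS0 : ∀ n, 0 ≤ S n) (hW : Monotone W) (hWpos : ∀ k, 0 < W (N k)) (hN : StrictMono N)
    (hratio : Tendsto (fun k => W (N (k + 1)) / W (N k)) atTop (𝓝 1))
    (hl : Tendsto (fun k => S (N k) / W (N k)) atTop (𝓝 l)) :
    Tendsto (fun n => S n / W n) atTop (𝓝 l) := by
  -- The last `k` with `N k ≤ n`; searching up to `n` suffices because `k ≤ N k`.
  set κ : ℕ → ℕ := fun n => Nat.findGreatest (fun k => N k ≤ n) n with hκ
  have hκ_top : Tendsto κ atTop atTop := by
    refine tendsto_atTop.2 fun j => ?_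
    filter_upwards [eventually_ge_atTop (N j)] with n hn
    exact Nat.le_findGreatest (hN.le_apply.trans hn) hn
  have hlow : ∀ᶠ n in atTop, N (κ n) ≤ n := by
    filter_upwards [eventually_ge_atTop (N 0)] with n hn
    exact Nat.findGreatest_spec (P := fun k => N k ≤ n) (Nat.zero_le n) hn
  have hup : ∀ n, n < N (κ n + 1) := by
    intro n
    by_contra! h
    have h1 : κ n + 1 ≤ κ n := Nat.le_findGreatest (hN.le_apply.trans h) h
    omega
  have h1 : Tendsto (fun k => S (N k) / W (N k) * (W (N (k + 1)) / W (N k))⁻¹) atTop (𝓝 l) := by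
    simpa using hl.mul (hratio.inv₀ one_ne_zero)
  have h2 : Tendsto (fun k => S (N (k + 1)) / W (N (k + 1)) * (W (N (k + 1)) / W (N k))) atTop
      (𝓝 l) := by
    simpa using (hl.comp (tendsto_add_atTop_nat 1)).mul hratio
  refine tendsto_of_tendsto_of_tendsto_of_le_of_le' (h1.comp hκ_top) (h2.comp hκ_top) ?_ ?_
  · filter_upwards [hlow] with n hn
    have hp1 := hWpos (κ n)
    have hp2 := hWpos (κ n + 1)
    have hp3 : 0 < W n := hp1.trans_le (hW hn)
    have : S (N (κ n)) / W (N (κ n)) * (W (N (κ n + 1)) / W (N (κ n)))⁻¹ =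
        S (N (κ n)) / W (N (κ n + 1)) := by field_simp
    simp only [Function.comp, this]
    exact div_le_div₀ (hS0 _) (hS hn) hp3 (hW (hup n).le)
  · filter_upwards [hlow] with n hn
    have hp1 := hWpos (κ n)
    have hp2 := hWpos (κ n + 1)
    have hp3 : 0 < W n := hp1.trans_le (hW hn)
    have : S (N (κ n + 1)) / W (N (κ n + 1)) * (W (N (κ n + 1)) / W (N (κ n))) =
        S (N (κ n + 1)) / W (N (κ n)) := by field_simp
    simp only [Function.comp, this]
    exact div_le_div₀ (hS0 _) (hS (hup n).le) hp1 (hW hn)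

lemma sum_range_nth {M : Type*} [AddCommMonoid M] {p : ℕ → Prop} [DecidablePred p]
    (hp : (Set.ofPred p).Infinite) (g : ℕ → M) (m : ℕ) :
    ∑ i ∈ Finset.range m, g (Nat.nth p i) =
      ∑ n ∈ Finset.range (Nat.nth p m), if p n then g n else 0 := by
  rw [← Finset.sum_filter, ← Finset.sum_image (f := g) (g := Nat.nth p)
    fun i _ j _ h => Nat.nth_injective hp h]
  refine Finset.sum_congr ?_ fun _ _ => rfl
  ext n
  simp only [Finset.mem_image, Finset.mem_range, Finset.mem_filter]
  constructor
  · rintro ⟨i, hi, rfl⟩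
    exact ⟨Nat.nth_strictMono hp hi, Nat.nth_mem_of_infinite hp i⟩
  · rintro ⟨hn, hpn⟩
    refine ⟨Nat.count p n, ?_, Nat.nth_count hpn⟩
    rw [← Nat.nth_lt_nth hp, Nat.nth_count hpn]
    exact hn

end Sequences

/-! ### Second moments of weighted ergodic sums -/

section AlmostEverywhere

variable {X : Type*} [MeasurableSpace X] {μ : Measure X}

lemma ae_summable_of_summable_integral {F : ℕ → X → ℝ} (hF : ∀ k, Integrable (F k) μ)
    (hF0 : ∀ k x, 0 ≤ F k x) (hs : Summable fun k => ∫ x, F k x ∂μ) :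
    ∀ᵐ x ∂μ, Summable fun k => F k x := by
  have h1 : ∫⁻ x, ∑' k, ENNReal.ofReal (F k x) ∂μ ≠ ⊤ := by
    rw [lintegral_tsum fun k => (hF k).1.aemeasurable.ennreal_ofReal]
    simp_rw [← ofReal_integral_eq_lintegral_ofReal (hF _) (ae_of_all _ (hF0 _))]
    exact hs.tsum_ofReal_ne_top
  filter_upwards [ae_lt_top' (AEMeasurable.tsum
    fun k => (hF k).1.aemeasurable.ennreal_ofReal) h1] with x hx
  have := ENNReal.summable_toReal hx.ne
  simpa only [ENNReal.toReal_ofReal (hF0 _ x)] using this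

variable {T : X → X}

lemma integral_mul_comp_iterate (hT : MeasurePreserving T μ μ) {f : X → ℝ} (hf : MemLp f 2 μ)
    (n h : ℕ) : ∫ x, f (T^[n] x) * f (T^[n + h] x) ∂μ = ∫ x, f x * f (T^[h] x) ∂μ := by
  have hTn := hT.iterate n
  have hm : AEStronglyMeasurable (fun x => f x * f (T^[h] x)) μ :=
    hf.1.mul (hf.1.comp_measurePreserving (hT.iterate h))
  have := integral_map (μ := μ) hTn.measurable.aemeasurable (f := fun x => f x * f (T^[h] x))
    (by rwa [hTn.map_eq])
  rw [hTn.map_eq] at this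
  rw [this]
  refine integral_congr_ae (ae_of_all _ fun x => ?_)
  simp only [← Function.iterate_add_apply, Nat.add_comm h n]

lemma MeasureTheory.MemLp.comp_iterate (hT : MeasurePreserving T μ μ) {E : Type*}
    [NormedAddCommGroup E] {f : X → E} {p : ENNReal} (hf : MemLp f p μ) (n : ℕ) :
    MemLp (fun x => f (T^[n] x)) p μ :=
  hf.comp_measurePreserving (hT.iterate n)

lemma abs_integral_mul_comp_iterate_le (hT : MeasurePreserving T μ μ) {f : X → ℝ}
    (hf : MemLp f 2 μ) (h : ℕ) : |∫ x, f x * f (T^[h] x) ∂μ| ≤ ∫ x, f x ^ 2 ∂μ := by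
  have h2 : ∫ x, f (T^[h] x) ^ 2 ∂μ = ∫ x, f x ^ 2 ∂μ := by
    have := integral_mul_comp_iterate hT hf h 0
    simpa [sq] using this
  have hi := (hf.comp_iterate hT h).integrable_sq
  have h3 : ∫ x, |f x * f (T^[h] x)| ∂μ ≤ ∫ x, (f x ^ 2 + f (T^[h] x) ^ 2) / 2 ∂μ := by
    refine integral_mono (hf.integrable_mul (hf.comp_iterate hT h)).abs
      ((hf.integrable_sq.add hi).div_const 2) fun x => ?_
    simp only [abs_mul]
    nlinarith [sq_nonneg (|f x| - |f (T^[h] x)|), sq_abs (f x), sq_abs (f (T^[h] x))]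
  rw [integral_div, integral_add hf.integrable_sq hi, h2] at h3
  refine (abs_integral_le_integral_abs).trans (h3.trans (le_of_eq ?_))
  ring

/-- The correlation at lag `h` is independent of `n`, so it factors out of the sum over `n` and is
bounded by `∫ f²`. This separates the system from the weights; the `2` comes from the off-diagonal
pairs. -/
lemma integral_sq_sum_comp_iterate_le (hT : MeasurePreserving T μ μ) {f : X → ℝ}
    (hf : MemLp f 2 μ) (c : ℕ → ℝ) (N : ℕ) :
    ∫ x, (∑ n ∈ Finset.range N, c n * f (T^[n] x)) ^ 2 ∂μ ≤
      2 * (∫ x, f x ^ 2 ∂μ) * autocorrelationSum c N := by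
  have hint : ∀ n h, Integrable (fun x => c n * f (T^[n] x) * (c (n + h) * f (T^[n + h] x))) μ :=
    fun n h => ((hf.comp_iterate hT n).const_mul (c n)).integrable_mul
      ((hf.comp_iterate hT (n + h)).const_mul (c (n + h)))
  have h0 : 0 ≤ ∫ x, f x ^ 2 ∂μ := integral_nonneg fun x => sq_nonneg _
  simp_rw [sq_sum_range_eq_sum_shift]
  rw [integral_finsetSum _ fun h _ => (integrable_finsetSum _ fun n _ => hint n h).const_mul _,
    autocorrelationSum, Finset.mul_sum]
  refine Finset.sum_le_sum fun h _ => ?_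
  rw [integral_const_mul, integral_finsetSum _ fun n _ => hint n h]
  have h1 : ∀ n, ∫ x, c n * f (T^[n] x) * (c (n + h) * f (T^[n + h] x)) ∂μ =
      c n * c (n + h) * ∫ x, f x * f (T^[h] x) ∂μ := by
    intro n
    rw [← integral_mul_comp_iterate hT hf n h, ← integral_const_mul]
    exact integral_congr_ae (ae_of_all _ fun x => by simp only; ring)
  simp_rw [h1]
  rw [← Finset.sum_mul]
  set D := ∑ n ∈ Finset.range (N - h), c n * c (n + h)
  have h2 : D * ∫ x, f x * f (T^[h] x) ∂μ ≤ |D| * ∫ x, f x ^ 2 ∂μ := by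
    refine (le_abs_self _).trans ?_
    rw [abs_mul]
    exact mul_le_mul_of_nonneg_left (abs_integral_mul_comp_iterate_le hT hf h) (abs_nonneg _)
  have h3 : 0 ≤ |D| * ∫ x, f x ^ 2 ∂μ := mul_nonneg (abs_nonneg _) h0
  split_ifs <;> linarith

end AlmostEverywhere

/-! ### From small autocorrelations to universal convergence -/

section Deterministic

/-- The set `Λ` has density `σ` at the scale of the sequence `N`: the sums of `σ` vary little
between consecutive terms of `N`, and the autocorrelations of `1_Λ - σ` are small along `N`. -/
structure HasRegularDensity (Λ : Set ℕ) (σ : ℕ → ℝ) (N : ℕ → ℕ) : Prop where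
  zero : σ 0 = 0
  nonneg : ∀ n, 0 ≤ σ n
  antitone : Antitone fun n => σ (n + 1)
  tendsto_sum : Tendsto (fun M : ℕ => ∑ n ∈ Finset.range M, σ n) atTop atTop
  strictMono : StrictMono N
  sum_pos : ∀ k, 0 < ∑ n ∈ Finset.range (N k), σ n
  tendsto_ratio : Tendsto (fun k =>
    (∑ n ∈ Finset.range (N (k + 1)), σ n) / ∑ n ∈ Finset.range (N k), σ n) atTop (𝓝 1)
  summable : Summable fun k =>
    autocorrelationSum (fun n => Λ.indicator 1 n - σ n) (N k) /
      (∑ n ∈ Finset.range (N k), σ n) ^ 2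

namespace HasRegularDensity

variable {Λ : Set ℕ} {σ : ℕ → ℝ} {N : ℕ → ℕ}
variable {X : Type*} [MeasurableSpace X] {μ : Measure X} {T : X → X}

/-- The normalised sums have summable second moments along `N`, so their squares are almost
everywhere summable and tend to zero. -/
lemma ae_tendsto_weighted_diff (H : HasRegularDensity Λ σ N)
    (hT : MeasurePreserving T μ μ) {f : X → ℝ} (hf : MemLp f 2 μ) :
    ∀ᵐ x ∂μ, Tendsto (fun k =>
      (∑ n ∈ Finset.range (N k), (Λ.indicator 1 n - σ n) * f (T^[n] x)) /
        ∑ n ∈ Finset.range (N k), σ n) atTop (𝓝 0) := by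
  set c : ℕ → ℝ := fun n => Λ.indicator 1 n - σ n with hc
  set W : ℕ → ℝ := fun M => ∑ n ∈ Finset.range M, σ n with hW
  have hmem : ∀ k, MemLp (fun x => ∑ n ∈ Finset.range (N k), c n * f (T^[n] x)) 2 μ := fun k =>
    memLp_finsetSum _ fun n _ => (hf.comp_iterate hT n).const_mul (c n)
  have h1 := ae_summable_of_summable_integral (μ := μ)
    (F := fun k x => (∑ n ∈ Finset.range (N k), c n * f (T^[n] x)) ^ 2 / W (N k) ^ 2)
    (fun k => (hmem k).integrable_sq.div_const _) (fun k x => by positivity) (by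
      refine Summable.of_nonneg_of_le (fun k => integral_nonneg fun x => by positivity)
        (fun k => ?_) (H.summable.mul_left (2 * ∫ x, f x ^ 2 ∂μ))
      rw [integral_div, ← mul_div_assoc]
      exact div_le_div_of_nonneg_right (integral_sq_sum_comp_iterate_le hT hf c (N k))
        (sq_nonneg _))
  filter_upwards [h1] with x hx
  have h2 := hx.tendsto_atTop_zero
  simp_rw [← div_pow] at h2
  have h3 := (Real.continuous_sqrt.tendsto 0).comp h2
  simp only [Function.comp_def, Real.sqrt_sq_eq_abs, Real.sqrt_zero] at h3
  exact (tendsto_zero_iff_abs_tendsto_zero _).2 h3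

/-- Along `N`, split `1_Λ = (1_Λ - σ) + σ`: the first part is negligible and the second is governed
by Birkhoff's theorem. Nonnegativity of `f` makes the sums monotone, which extends the limit to all
`M`. -/
lemma ae_tendsto_of_nonneg [IsProbabilityMeasure μ] (H : HasRegularDensity Λ σ N)
    (hT : MeasurePreserving T μ μ) {f : X → ℝ} (hf : MemLp f 2 μ) (hf0 : ∀ x, 0 ≤ f x) :
    ∀ᵐ x ∂μ, Tendsto (fun M : ℕ =>
      (∑ n ∈ Finset.range M, Λ.indicator 1 n * f (T^[n] x)) / ∑ n ∈ Finset.range M, σ n) atTop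
      (𝓝 ((μ[f | invariantsMod T μ]) x)) := by
  filter_upwards [H.ae_tendsto_weighted_diff hT hf,
    ae_tendsto_birkhoff hT (hf.integrable one_le_two)] with x h1 h2
  have h3 := (tendsto_weighted_of_tendsto_cesaro_of_zero H.zero H.antitone H.nonneg
    H.tendsto_sum h2).comp H.strictMono.tendsto_atTop
  have h4 : ∀ n, 0 ≤ Λ.indicator (1 : ℕ → ℝ) n := fun n =>
    Set.indicator_nonneg (fun _ _ => zero_le_one) n
  refine tendsto_div_of_tendsto_subseq (N := N) ?_
    (fun M => Finset.sum_nonneg fun n _ => mul_nonneg (h4 n) (hf0 _)) ?_ H.sum_pos H.strictMono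
    H.tendsto_ratio ?_
  · exact monotone_nat_of_le_succ fun M => by
      rw [Finset.sum_range_succ]
      exact le_add_of_nonneg_right (mul_nonneg (h4 M) (hf0 _))
  · exact monotone_nat_of_le_succ fun M => by
      rw [Finset.sum_range_succ]
      exact le_add_of_nonneg_right (H.nonneg M)
  · have h5 := h1.add h3
    rw [zero_add] at h5
    refine h5.congr fun k => ?_
    simp only [Function.comp_def]
    rw [← add_div, ← Finset.sum_add_distrib]
    congr 1
    exact Finset.sum_congr rfl fun n _ => by ring

/-- The previous convergence for `f = 1` on the one-point system. -/
lemma tendsto_count_div (H : HasRegularDensity Λ σ N) :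
    Tendsto (fun M : ℕ => (∑ n ∈ Finset.range M, Λ.indicator (1 : ℕ → ℝ) n) /
      ∑ n ∈ Finset.range M, σ n) atTop (𝓝 1) := by
  have h := H.ae_tendsto_of_nonneg (μ := Measure.dirac ()) (MeasurePreserving.id _)
    (memLp_const (1 : ℝ)) fun _ => zero_le_one
  obtain ⟨x, hx⟩ := h.exists
  have h1 : (Measure.dirac ())[fun _ => (1 : ℝ) | invariantsMod id (Measure.dirac ())] x = 1 :=
    congrFun (condExp_const (invariantsMod_le _ _) (1 : ℝ)) x
  rw [h1] at hx
  simpa only [mul_one] using hx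

open Classical in
lemma infinite (H : HasRegularDensity Λ σ N) : Λ.Infinite := by
  intro hfin
  have h1 := Tendsto.pos_mul_atTop zero_lt_one H.tendsto_count_div H.tendsto_sum
  have h2 : Tendsto (fun M : ℕ => ∑ n ∈ Finset.range M, Λ.indicator (1 : ℕ → ℝ) n) atTop atTop := by
    refine h1.congr' ?_
    filter_upwards [H.tendsto_sum.eventually_gt_atTop 0] with M hM
    exact div_mul_cancel₀ _ hM.ne'
  obtain ⟨M, hM⟩ := (h2.eventually_gt_atTop (hfin.toFinset.card : ℝ)).exists
  refine absurd hM (not_lt.2 ?_)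
  simp only [Set.indicator_apply, Pi.one_apply, Finset.sum_boole, Nat.cast_le]
  exact Finset.card_le_card fun n hn => by simpa using (Finset.mem_filter.1 hn).2

-- Exactly `M` elements of `Λ` lie below its `M`-th element (counted from `0`), so dividing by
-- `tendsto_count_div` replaces the normalisation by `W` with `M`.
open Classical in
lemma ae_tendsto_nth_of_nonneg [IsProbabilityMeasure μ] (H : HasRegularDensity Λ σ N)
    (hT : MeasurePreserving T μ μ) {f : X → ℝ} (hf : MemLp f 2 μ) (hf0 : ∀ x, 0 ≤ f x) :
    ∀ᵐ x ∂μ, Tendsto (fun M : ℕ =>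
      (M : ℝ)⁻¹ * ∑ n ∈ Finset.range M, f (T^[Nat.nth (fun n => n ∈ Λ) n] x)) atTop
      (𝓝 ((μ[f | invariantsMod T μ]) x)) := by
  have hinf : (Set.ofPred fun n => n ∈ Λ).Infinite := H.infinite
  filter_upwards [H.ae_tendsto_of_nonneg hT hf hf0] with x hx
  have h1 := ((hx.div H.tendsto_count_div one_ne_zero).comp
    (Nat.nth_strictMono hinf).tendsto_atTop)
  rw [div_one] at h1
  refine h1.congr' ?_
  filter_upwards [(H.tendsto_sum.comp (Nat.nth_strictMono hinf).tendsto_atTop).eventually_gt_atTop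
    0] with M hM
  have h2 : (M : ℝ) = ∑ n ∈ Finset.range (Nat.nth (fun n => n ∈ Λ) M),
      Λ.indicator (1 : ℕ → ℝ) n := by
    have := sum_range_nth hinf (fun _ => (1 : ℝ)) M
    simpa [Set.indicator_apply] using this
  rw [sum_range_nth hinf (fun n => f (T^[n] x)) M]
  simp only [Function.comp_apply, Pi.div_apply] at hM ⊢
  rw [div_div_div_cancel_right₀ hM.ne', ← h2, inv_mul_eq_div]
  congr 1
  exact Finset.sum_congr rfl fun n _ => by simp [Set.indicator_apply]

lemma ae_tendsto_nth_real [IsProbabilityMeasure μ] (H : HasRegularDensity Λ σ N)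
    (hT : MeasurePreserving T μ μ) {f : X → ℝ} (hf : MemLp f 2 μ) :
    ∀ᵐ x ∂μ, Tendsto (fun M : ℕ =>
      (M : ℝ)⁻¹ * ∑ n ∈ Finset.range M, f (T^[Nat.nth (fun n => n ∈ Λ) n] x)) atTop
      (𝓝 ((μ[f | invariantsMod T μ]) x)) := by
  have hp : MemLp (fun x => max (f x) 0) 2 μ := hf.pos_part
  have hn : MemLp (fun x => max (-f x) 0) 2 μ := hf.neg_part
  have hsub : f = (fun x => max (f x) 0) - fun x => max (-f x) 0 := by
    funext x
    simp only [Pi.sub_apply]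
    rcases le_total 0 (f x) with h | h
    · rw [max_eq_left h, max_eq_right (neg_nonpos.2 h), sub_zero]
    · rw [max_eq_right h, max_eq_left (neg_nonneg.2 h), zero_sub, neg_neg]
  have hcond := condExp_sub (hp.integrable one_le_two) (hn.integrable one_le_two)
    (invariantsMod T μ)
  rw [← hsub] at hcond
  filter_upwards [H.ae_tendsto_nth_of_nonneg hT hp fun _ => le_max_right _ _,
    H.ae_tendsto_nth_of_nonneg hT hn fun _ => le_max_right _ _, hcond] with x h1 h2 h3
  rw [h3]
  refine (h1.sub h2).congr fun M => ?_
  rw [← mul_sub, ← Finset.sum_sub_distrib]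
  congr 1
  exact Finset.sum_congr rfl fun n _ => (congrFun hsub _).symm

theorem ae_tendsto_ergodicAverage [IsProbabilityMeasure μ] (H : HasRegularDensity Λ σ N)
    (hT : MeasurePreserving T μ μ) {f : X → ℂ} (hf : MemLp f 2 μ) :
    ∀ᵐ x ∂μ, Tendsto (fun M : ℕ => ergodicAverage T (Nat.nth fun n => n ∈ Λ) f M x) atTop
      (𝓝 ((μ[f | invariantsMod T μ]) x)) := by
  have hi := hf.integrable one_le_two
  filter_upwards [H.ae_tendsto_nth_real hT hf.re, H.ae_tendsto_nth_real hT hf.im,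
    Complex.reCLM.comp_condExp_comm hi (m := invariantsMod T μ),
    Complex.imCLM.comp_condExp_comm hi (m := invariantsMod T μ)] with x h1 h2 h3 h4
  have h3' : (μ[fun x => (f x).re | invariantsMod T μ]) x = ((μ[f | invariantsMod T μ]) x).re :=
    h3.symm
  have h4' : (μ[fun x => (f x).im | invariantsMod T μ]) x = ((μ[f | invariantsMod T μ]) x).im :=
    h4.symm
  simp only [RCLike.re_to_complex, RCLike.im_to_complex] at h1 h2
  rw [h3'] at h1
  rw [h4'] at h2
  have h5 := ((Complex.continuous_ofReal.tendsto _).comp h1).add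
    (((Complex.continuous_ofReal.tendsto _).comp h2).mul_const Complex.I)
  rw [Complex.re_add_im] at h5
  refine h5.congr fun M => ?_
  have h6 : ((M : ℂ)⁻¹) = (((M : ℝ)⁻¹ : ℝ) : ℂ) := by push_cast; rfl
  apply Complex.ext <;>
  simp [ergodicAverage, h6, -Complex.ofReal_inv]

theorem pointwiseUniversallyGood (H : HasRegularDensity Λ σ N) :
    PointwiseUniversallyGood.{u} 2 (Nat.nth fun n => n ∈ Λ) := fun X _ μ _ T hT f hf => by
  filter_upwards [H.ae_tendsto_ergodicAverage hT hf] with x hx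
  exact ⟨_, hx⟩

end HasRegularDensity

/-! ### Convergence in the mean -/

section MeanConvergence

variable {X : Type*} {T : X → X} (r : ℕ → ℕ)

lemma ergodicAverage_sub (f g : X → ℂ) (N : ℕ) :
    ergodicAverage T r (f - g) N = ergodicAverage T r f N - ergodicAverage T r g N := by
  funext x
  simp [ergodicAverage, Finset.sum_sub_distrib, mul_sub]

lemma norm_ergodicAverage_le {f : X → ℂ} {C : ℝ} (hC : ∀ x, ‖f x‖ ≤ C) (N : ℕ) (x : X) :
    ‖ergodicAverage T r f N x‖ ≤ C := by
  have hC0 : 0 ≤ C := (norm_nonneg _).trans (hC x)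
  rcases Nat.eq_zero_or_pos N with rfl | hN
  · simpa [ergodicAverage] using hC0
  have hN' : (0 : ℝ) < N := by exact_mod_cast hN
  rw [ergodicAverage, norm_mul, norm_inv, Complex.norm_natCast, inv_mul_le_iff₀ hN']
  refine (norm_sum_le _ _).trans ((Finset.sum_le_sum fun n _ => hC _).trans (le_of_eq ?_))
  simp

variable [MeasurableSpace X] {μ : Measure X}

lemma aestronglyMeasurable_ergodicAverage (hT : MeasurePreserving T μ μ) {f : X → ℂ}
    (hf : AEStronglyMeasurable f μ) (N : ℕ) :
    AEStronglyMeasurable (ergodicAverage T r f N) μ :=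
  (Finset.aestronglyMeasurable_fun_sum _ fun n _ =>
    hf.comp_measurePreserving (hT.iterate (r n))).const_mul _

lemma eLpNorm_ergodicAverage_le (hT : MeasurePreserving T μ μ) {f : X → ℂ}
    (hf : AEStronglyMeasurable f μ) {p : ENNReal} (hp : 1 ≤ p) (N : ℕ) :
    eLpNorm (ergodicAverage T r f N) p μ ≤ eLpNorm f p μ := by
  have h1 : ergodicAverage T r f N =
      (N : ℂ)⁻¹ • ∑ n ∈ Finset.range N, fun x => f (T^[r n] x) := by
    funext x
    simp [ergodicAverage]
  have h2 : ∀ n, eLpNorm (fun x => f (T^[r n] x)) p μ = eLpNorm f p μ := fun n =>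
    eLpNorm_comp_measurePreserving hf (hT.iterate (r n))
  rw [h1, eLpNorm_const_smul]
  have h3 := eLpNorm_sum_le (s := Finset.range N) (fun n _ =>
    hf.comp_measurePreserving (hT.iterate (r n))) hp
  have h4 : eLpNorm (∑ n ∈ Finset.range N, fun x => f (T^[r n] x)) p μ ≤
      N * eLpNorm f p μ := by
    refine h3.trans (le_of_eq ?_)
    simp only [Function.comp_def, h2, Finset.sum_const, Finset.card_range, nsmul_eq_mul]
  rcases Nat.eq_zero_or_pos N with rfl | hN
  · simp
  refine (mul_le_mul_right h4 _).trans ?_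
  rw [← mul_assoc]
  refine mul_le_of_le_one_left' (le_of_eq ?_)
  have hN' : (N : ℂ) ≠ 0 := by exact_mod_cast hN.ne'
  rw [enorm_inv hN', ← ENNReal.ofReal_natCast, ← ofReal_norm, Complex.norm_natCast]
  exact ENNReal.inv_mul_cancel (by simpa using hN.ne') ENNReal.ofReal_ne_top

/-- The averages of a bounded function share its bound, hence are uniformly integrable, and Vitali's
theorem applies. -/
lemma tendsto_eLpNorm_ergodicAverage_of_bounded [IsProbabilityMeasure μ]
    (hT : MeasurePreserving T μ μ) {f g : X → ℂ} (hf : AEStronglyMeasurable f μ)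
    (hg : MemLp g 2 μ) {C : ℝ} (hC : ∀ x, ‖f x‖ ≤ C)
    (h : ∀ᵐ x ∂μ, Tendsto (fun N => ergodicAverage T r f N x) atTop (𝓝 (g x))) :
    Tendsto (fun N => eLpNorm (ergodicAverage T r f N - g) 2 μ) atTop (𝓝 0) := by
  refine tendsto_Lp_finite_of_tendsto_ae one_le_two ENNReal.ofNat_ne_top
    (aestronglyMeasurable_ergodicAverage r hT hf) hg ?_ h
  refine unifIntegrable_of one_le_two ENNReal.ofNat_ne_top
    (aestronglyMeasurable_ergodicAverage r hT hf) fun ε _ => ⟨(C + 1).toNNReal, fun N => ?_⟩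
  have h1 : {x | (C + 1).toNNReal ≤ ‖ergodicAverage T r f N x‖₊} = ∅ := by
    refine Set.eq_empty_of_forall_notMem fun x hx => ?_
    have h2 : (C + 1).toNNReal ≤ ‖ergodicAverage T r f N x‖₊ := hx
    rw [Real.toNNReal_le_iff_le_coe, coe_nnnorm] at h2
    linarith [norm_ergodicAverage_le (T := T) r hC N x]
  rw [h1]
  simp

end MeanConvergence

theorem HasRegularDensity.isErgodicSequence {Λ : Set ℕ} {σ : ℕ → ℝ} {N : ℕ → ℕ}
    (H : HasRegularDensity Λ σ N) :
    IsErgodicSequence.{u} (Nat.nth fun n => n ∈ Λ) := by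
  intro X _ μ _ T hT f hf
  set r := Nat.nth fun n => n ∈ Λ
  refine ENNReal.tendsto_nhds_zero.2 fun ε hε => ?_
  -- Averaging and conditional expectation both contract the `L²` norm, so replacing `f` by a simple
  -- function costs `ε / 3` in each.
  obtain ⟨g, hg, hgm⟩ := hf.exists_simpleFunc_eLpNorm_sub_lt ENNReal.ofNat_ne_top
    (ENNReal.div_pos hε.ne' (ENNReal.ofNat_ne_top (n := 3))).ne'
  obtain ⟨C, hC⟩ := g.exists_forall_norm_le
  have h1 := tendsto_eLpNorm_ergodicAverage_of_bounded r hT hgm.1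
    (hgm.condExp one_le_two (m := invariantsMod T μ)) hC
    (H.ae_tendsto_ergodicAverage hT hgm)
  filter_upwards [ENNReal.tendsto_nhds_zero.1 h1 (ε / 3) (ENNReal.div_pos hε.ne' (by simp))]
    with M hM
  have hfg : MemLp (f - ⇑g) 2 μ := hf.sub hgm
  have h2 : eLpNorm (ergodicAverage T r (f - ⇑g) M) 2 μ ≤ ε / 3 :=
    (eLpNorm_ergodicAverage_le r hT hfg.1 one_le_two M).trans hg.le
  have h3 : eLpNorm (μ[f - ⇑g | invariantsMod T μ]) 2 μ ≤ ε / 3 :=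
    (eLpNorm_condExp_le_eLpNorm _ one_le_two).trans hg.le
  have h4 : (ergodicAverage T r f M - μ[f | invariantsMod T μ] : X → ℂ) =ᵐ[μ]
      ergodicAverage T r (f - ⇑g) M + (ergodicAverage T r (⇑g) M - μ[⇑g | invariantsMod T μ]) - μ[f - ⇑g | invariantsMod T μ] := by
    filter_upwards [condExp_sub (hf.integrable one_le_two) (hgm.integrable one_le_two)
      (invariantsMod T μ)] with x hx
    rw [ergodicAverage_sub]
    simp only [Pi.sub_apply, Pi.add_apply] at hx ⊢
    rw [hx]
    ring
  have h5 := aestronglyMeasurable_ergodicAverage r hT hfg.1 M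
  have h6 : AEStronglyMeasurable (ergodicAverage T r (⇑g) M - μ[⇑g | invariantsMod T μ]) μ :=
    (aestronglyMeasurable_ergodicAverage r hT hgm.1 M).sub integrable_condExp.1
  rw [eLpNorm_congr_ae h4]
  calc _ ≤ _ := eLpNorm_sub_le (h5.add h6) integrable_condExp.1 one_le_two
    _ ≤ (ε / 3 + ε / 3) + ε / 3 :=
      add_le_add ((eLpNorm_add_le h5 h6 one_le_two).trans (add_le_add h2 hM)) h3
    _ = ε := ENNReal.add_thirds ε

end Deterministic

/-! ### The Gauss map, its transfer operator and decay of correlations -/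

section GaussMap

lemma measurable_gaussMap : Measurable gaussMap :=
  Measurable.ite (measurableSet_singleton (0 : ℝ)) measurable_const
    (measurable_fract.comp (measurable_const.div measurable_id))

/-- The density of the Gauss measure. -/
noncomputable def gaussDensity (x : ℝ) : ℝ := 1 / (Real.log 2 * (1 + x))

lemma measurable_gaussDensity : Measurable gaussDensity :=
  measurable_const.div (measurable_const.mul (measurable_const.add measurable_id))

lemma gaussMeasure_eq_withDensity : gaussMeasure =
    (volume.restrict (Set.Ico (0 : ℝ) 1)).withDensity fun x => ENNReal.ofReal (gaussDensity x) :=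
  rfl

lemma lintegral_gaussMeasure {H : ℝ → ENNReal} (hH : Measurable H) :
    ∫⁻ x, H x ∂gaussMeasure =
      ∫⁻ x in Set.Ico 0 1, ENNReal.ofReal (gaussDensity x) * H x := by
  rw [gaussMeasure_eq_withDensity, lintegral_withDensity_eq_lintegral_mul _
    (measurable_gaussDensity.ennreal_ofReal) hH]
  rfl

lemma gaussMeasure_Ioo {t : ℝ} (ht0 : 0 ≤ t) (ht1 : t ≤ 1) :
    gaussMeasure (Set.Ioo 0 t) = ENNReal.ofReal (Real.log (1 + t) / Real.log 2) := by
  have hlog : 0 < Real.log 2 := Real.log_pos one_lt_two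
  have hsub : Set.Ioo 0 t ⊆ Set.Ico 0 1 := fun x hx => ⟨hx.1.le, hx.2.trans_le ht1⟩
  rw [gaussMeasure, withDensity_apply _ measurableSet_Ioo, Measure.restrict_restrict
    measurableSet_Ioo, Set.inter_eq_left.2 hsub,
    restrict_Ioo_eq_restrict_Ioc]
  have hcont : ContinuousOn (fun x : ℝ => 1 / (Real.log 2 * (1 + x))) (Set.Icc 0 t) := by
    refine continuousOn_const.div (by fun_prop) fun x hx => ?_
    have : 0 < 1 + x := by linarith [hx.1]
    positivity
  have hint : IntervalIntegrable (fun x : ℝ => 1 / (Real.log 2 * (1 + x))) volume 0 t :=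
    ContinuousOn.intervalIntegrable (by rwa [Set.uIcc_of_le ht0])
  rw [← ofReal_integral_eq_lintegral_ofReal
    ((intervalIntegrable_iff_integrableOn_Ioc_of_le ht0).1 hint), ← intervalIntegral.integral_of_le ht0]
  · congr 1
    have hd : ∀ x ∈ Set.uIcc 0 t, HasDerivAt (fun x => Real.log (1 + x) / Real.log 2)
        (1 / (Real.log 2 * (1 + x))) x := by
      intro x hx
      rw [Set.uIcc_of_le ht0] at hx
      have hx1 : 0 < 1 + x := by linarith [hx.1]
      have h0 : HasDerivAt (fun x : ℝ => 1 + x) 1 x := (hasDerivAt_id x).const_add 1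
      have h1 := (h0.log hx1.ne').div_const (Real.log 2)
      rwa [div_div, mul_comm] at h1
    rw [intervalIntegral.integral_eq_sub_of_hasDerivAt hd hint]
    simp
  · refine (ae_restrict_iff' measurableSet_Ioc).2 (ae_of_all _ fun x hx => ?_)
    have hx1 : 0 < 1 + x := by linarith [hx.1]
    simp only [Pi.zero_apply]
    positivity

lemma ae_gaussMeasure_mem_Ioo : ∀ᵐ x ∂gaussMeasure, x ∈ Set.Ioo (0 : ℝ) 1 := by
  refine (withDensity_absolutelyContinuous _ _).ae_le ?_
  rw [← restrict_Ioo_eq_restrict_Ico]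
  exact ae_restrict_mem measurableSet_Ioo

instance : IsProbabilityMeasure gaussMeasure where
  measure_univ := by
    have h1 : gaussMeasure Set.univ = gaussMeasure (Set.Ioo 0 1) :=
      measure_congr (by
        filter_upwards [ae_gaussMeasure_mem_Ioo] with x hx
        exact propext ⟨fun _ => hx, fun _ => trivial⟩)
    have hlog : 0 < Real.log 2 := Real.log_pos one_lt_two
    rw [h1, gaussMeasure_Ioo zero_le_one le_rfl, one_add_one_eq_two, div_self hlog.ne',
      ENNReal.ofReal_one]

lemma ae_volume_of_ae_gaussMeasure {p : ℝ → Prop} (h : ∀ᵐ x ∂gaussMeasure, p x) :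
    ∀ᵐ x ∂(volume.restrict (Set.Ico (0 : ℝ) 1)), p x := by
  rw [gaussMeasure_eq_withDensity, ae_withDensity_iff measurable_gaussDensity.ennreal_ofReal] at h
  filter_upwards [h, ae_restrict_mem measurableSet_Ico] with x hx hx0
  refine hx ?_
  have hlog : 0 < Real.log 2 := Real.log_pos one_lt_two
  have hx1 : 0 < 1 + x := by linarith [hx0.1]
  rw [Ne, ENNReal.ofReal_eq_zero, not_le]
  unfold gaussDensity
  positivity

/-- The transition weights of the transfer operator of the Gauss map. -/
noncomputable def gaussWeight (k : ℕ) (x : ℝ) : ℝ := (1 + x) / ((k + 1 + x) * (k + 2 + x))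

/-- The transfer operator of the Gauss map with respect to the Gauss measure. -/
noncomputable def gaussTransfer (f : ℝ → ℝ) (x : ℝ) : ℝ :=
  ∑' k : ℕ, gaussWeight k x * f (1 / (k + 1 + x))

lemma measurable_gaussWeight (k : ℕ) : Measurable (gaussWeight k) := by
  unfold gaussWeight
  fun_prop

lemma measurable_gaussTransfer {f : ℝ → ℝ} (hf : Measurable f) : Measurable (gaussTransfer f) :=
  Measurable.tsum fun k => (measurable_gaussWeight k).mul (hf.comp (by fun_prop))

lemma gaussWeight_nonneg (k : ℕ) {x : ℝ} (hx : 0 ≤ x) : 0 ≤ gaussWeight k x := by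
  unfold gaussWeight
  positivity

/-- The weights telescope, being `(1+x)(1/(k+1+x) - 1/(k+2+x))`. That the partial sums decrease in
`x` is what makes the transfer operator reverse monotonicity. -/
lemma sum_gaussWeight (n : ℕ) {x : ℝ} (hx : 0 ≤ x) :
    ∑ k ∈ Finset.range n, gaussWeight k x = n / (n + 1 + x) := by
  induction n with
  | zero => simp
  | succ n ih =>
    rw [Finset.sum_range_succ, ih, gaussWeight]
    have h1 : (n : ℝ) + 1 + x ≠ 0 := by positivity
    have h2 : (n : ℝ) + 2 + x ≠ 0 := by positivity
    have h3 : (n : ℝ) + 1 + 1 + x ≠ 0 := by positivity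
    push_cast
    field_simp
    ring

lemma hasSum_gaussWeight {x : ℝ} (hx : 0 ≤ x) : HasSum (fun k => gaussWeight k x) 1 := by
  rw [hasSum_iff_tendsto_nat_of_nonneg fun k => gaussWeight_nonneg k hx]
  simp_rw [sum_gaussWeight _ hx]
  have h1 : Tendsto (fun n : ℕ => ((n : ℝ) + (1 + x))) atTop atTop :=
    tendsto_atTop_add_const_right _ _ tendsto_natCast_atTop_atTop
  have h2 : Tendsto (fun n : ℕ => 1 - (1 + x) / ((n : ℝ) + (1 + x))) atTop (𝓝 (1 - 0)) :=
    tendsto_const_nhds.sub (tendsto_const_nhds.div_atTop h1)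
  rw [sub_zero] at h2
  refine h2.congr fun n => ?_
  have h1 : (n : ℝ) + (1 + x) ≠ 0 := by positivity
  have h3 : (n : ℝ) + 1 + x ≠ 0 := by positivity
  field_simp
  ring

lemma one_div_mem_Icc (k : ℕ) {x : ℝ} (hx : 0 ≤ x) : 1 / ((k : ℝ) + 1 + x) ∈ Set.Icc (0 : ℝ) 1 := by
  refine ⟨by positivity, ?_⟩
  rw [div_le_one (by positivity)]
  have : (0 : ℝ) ≤ k := k.cast_nonneg
  linarith

lemma summable_gaussTransfer {f : ℝ → ℝ} {C : ℝ} (hC : ∀ x ∈ Set.Icc (0 : ℝ) 1, |f x| ≤ C) {x : ℝ}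
    (hx : 0 ≤ x) : Summable fun k : ℕ => gaussWeight k x * f (1 / (k + 1 + x)) := by
  refine Summable.of_norm_bounded ((hasSum_gaussWeight hx).summable.mul_right C) fun k => ?_
  rw [norm_mul, Real.norm_of_nonneg (gaussWeight_nonneg k hx), Real.norm_eq_abs]
  exact mul_le_mul_of_nonneg_left (hC _ (one_div_mem_Icc k hx)) (gaussWeight_nonneg k hx)

lemma gaussMap_one_div (k : ℕ) {x : ℝ} (hx : x ∈ Set.Ico (0 : ℝ) 1) :
    gaussMap (1 / (k + 1 + x)) = x := by
  have h1 : (0 : ℝ) < k + 1 + x := by linarith [hx.1, (k.cast_nonneg : (0 : ℝ) ≤ k)]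
  rw [gaussMap, if_neg (by positivity), one_div_one_div]
  have : (k : ℝ) + 1 + x = x + ((k + 1 : ℕ) : ℝ) := by push_cast; ring
  rw [this, Int.fract_add_natCast, Int.fract_eq_self]
  exact hx

lemma image_gaussBranch (k : ℕ) : (fun x : ℝ => 1 / ((k : ℝ) + 1 + x)) '' Set.Ico 0 1 =
    Set.Ioc (1 / ((k : ℝ) + 2)) (1 / ((k : ℝ) + 1)) := by
  have hk : (0 : ℝ) ≤ k := k.cast_nonneg
  ext y
  constructor
  · rintro ⟨x, hx, rfl⟩
    exact ⟨one_div_lt_one_div_of_lt (by linarith [hx.1]) (by linarith [hx.2]),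
      one_div_le_one_div_of_le (by positivity) (by linarith [hx.1])⟩
  · rintro ⟨h1, h2⟩
    have hy : 0 < y := lt_trans (by positivity) h1
    refine ⟨1 / y - (k + 1), ⟨?_, ?_⟩, ?_⟩
    · rw [le_div_iff₀ (by positivity)] at h2
      rw [sub_nonneg, le_div_iff₀ hy]
      linarith
    · rw [div_lt_iff₀ (by positivity)] at h1
      rw [sub_lt_iff_lt_add, div_lt_iff₀ hy]
      linarith
    · simp only [add_sub_cancel, one_div_one_div]

lemma iUnion_gaussBranch :
    ⋃ k : ℕ, Set.Ioc (1 / ((k : ℝ) + 2)) (1 / ((k : ℝ) + 1)) = Set.Ioc 0 1 := by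
  ext y
  simp only [Set.mem_iUnion, Set.mem_Ioc]
  constructor
  · rintro ⟨k, h1, h2⟩
    refine ⟨lt_trans (by positivity) h1, h2.trans ?_⟩
    rw [div_le_one (by positivity)]
    linarith [(k.cast_nonneg : (0 : ℝ) ≤ k)]
  · rintro ⟨h1, h2⟩
    have h3 : 1 ≤ 1 / y := by rwa [le_div_iff₀ h1, one_mul]
    have h4 : 1 ≤ ⌊1 / y⌋₊ := Nat.le_floor (by simpa using h3)
    have h5 : ((⌊1 / y⌋₊ - 1 : ℕ) : ℝ) + 1 = ⌊1 / y⌋₊ := by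
      rw [← Nat.cast_add_one, Nat.sub_add_cancel h4]
    refine ⟨⌊1 / y⌋₊ - 1, ?_, ?_⟩
    · have h6 := Nat.lt_floor_add_one (1 / y)
      rw [div_lt_iff₀ (by positivity), show ((⌊1 / y⌋₊ - 1 : ℕ) : ℝ) + 2 = ⌊1 / y⌋₊ + 1 by linarith]
      rw [div_lt_iff₀ h1] at h6
      linarith
    · have h6 := Nat.floor_le (zero_le_one.trans h3)
      rw [le_div_iff₀ (by positivity), h5]
      rw [le_div_iff₀ h1] at h6
      linarith

lemma pairwise_disjoint_gaussBranch : Pairwise (Function.onFun Disjoint fun k : ℕ =>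
    Set.Ioc (1 / ((k : ℝ) + 2)) (1 / ((k : ℝ) + 1))) := by
  refine (pairwise_disjoint_on _).2 fun m n hmn => Set.disjoint_left.2 ?_
  rintro y ⟨h1, -⟩ ⟨-, h2⟩
  have h3 : (m : ℝ) + 1 ≤ n := by exact_mod_cast hmn
  have h4 : 1 / ((n : ℝ) + 1) ≤ 1 / ((m : ℝ) + 2) :=
    one_div_le_one_div_of_le (by positivity) (by linarith)
  linarith

/-- Change of variables on each inverse branch `x ↦ 1/(k+1+x)`: the Gauss density at the image times
the Jacobian is the weight times the density at `x`. -/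
lemma lintegral_gaussMeasure_eq_transfer {H : ℝ → ENNReal} (hH : Measurable H) :
    ∫⁻ x, H x ∂gaussMeasure =
      ∫⁻ x, ∑' k : ℕ, ENNReal.ofReal (gaussWeight k x) * H (1 / (k + 1 + x)) ∂gaussMeasure := by
  have hm : ∀ k : ℕ, Measurable fun x : ℝ =>
      ENNReal.ofReal (gaussWeight k x) * H (1 / (k + 1 + x)) := fun k =>
    (measurable_gaussWeight k).ennreal_ofReal.mul (hH.comp (by fun_prop))
  have hm' : ∀ k : ℕ, Measurable fun x : ℝ => ENNReal.ofReal (gaussDensity x) *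
      (ENNReal.ofReal (gaussWeight k x) * H (1 / (k + 1 + x))) := fun k =>
    measurable_gaussDensity.ennreal_ofReal.mul (hm k)
  rw [lintegral_gaussMeasure (Measurable.tsum hm), lintegral_gaussMeasure hH]
  nth_rewrite 1 [restrict_Ico_eq_restrict_Ioc]
  rw [← iUnion_gaussBranch,
    lintegral_iUnion (fun k => measurableSet_Ioc) pairwise_disjoint_gaussBranch]
  simp_rw [← ENNReal.tsum_mul_left]
  rw [lintegral_tsum fun k => (hm' k).aemeasurable]
  congr 1
  funext k
  have hk : (0 : ℝ) ≤ k := k.cast_nonneg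
  have hd : ∀ x ∈ Set.Ico (0 : ℝ) 1, HasDerivWithinAt (fun x : ℝ => 1 / ((k : ℝ) + 1 + x))
      (-1 / ((k : ℝ) + 1 + x) ^ 2) (Set.Ico 0 1) x := by
    intro x hx
    have h1 : (k : ℝ) + 1 + x ≠ 0 := by linarith [hx.1]
    have h2 : HasDerivAt (fun x : ℝ => (k : ℝ) + 1 + x) 1 x := (hasDerivAt_id x).const_add _
    simp only [one_div]
    exact (h2.inv h1).hasDerivWithinAt
  have hinj : Set.InjOn (fun x : ℝ => 1 / ((k : ℝ) + 1 + x)) (Set.Ico 0 1) := by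
    intro x _ y _ hxy
    simpa using hxy
  rw [← image_gaussBranch, lintegral_image_eq_lintegral_abs_deriv_mul measurableSet_Ico hd hinj]
  refine setLIntegral_congr_fun measurableSet_Ico fun x hx => ?_
  have hx0 : 0 ≤ x := hx.1
  have hlog : 0 < Real.log 2 := Real.log_pos one_lt_two
  rw [← mul_assoc, ← mul_assoc, ← ENNReal.ofReal_mul (abs_nonneg _), ← ENNReal.ofReal_mul
    (by unfold gaussDensity; positivity)]
  congr 2
  have h1 : |(-1 : ℝ) / ((k : ℝ) + 1 + x) ^ 2| = 1 / ((k : ℝ) + 1 + x) ^ 2 := by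
    rw [abs_div, abs_neg, abs_one, abs_of_nonneg (by positivity)]
  rw [h1, gaussDensity, gaussDensity, gaussWeight]
  have h2 : (k : ℝ) + 1 + x ≠ 0 := by positivity
  have h3 : (k : ℝ) + 2 + x ≠ 0 := by positivity
  have h4 : 1 + x ≠ 0 := by positivity
  have h5 : 1 + 1 / ((k : ℝ) + 1 + x) = ((k : ℝ) + 2 + x) / ((k : ℝ) + 1 + x) := by
    field_simp; ring
  rw [h5]
  field_simp

/-- The indicator of `G⁻¹ A` takes the value `1_A(x)` at every preimage of `x`, and the weights sum
to `1`. -/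
lemma measurePreserving_gaussMap : MeasurePreserving gaussMap gaussMeasure gaussMeasure := by
  refine ⟨measurable_gaussMap, Measure.ext fun A hA => ?_⟩
  rw [Measure.map_apply measurable_gaussMap hA,
    ← lintegral_indicator_one (measurable_gaussMap hA), ← lintegral_indicator_one hA,
    lintegral_gaussMeasure_eq_transfer
      (measurable_one.indicator (measurable_gaussMap hA))]
  refine lintegral_congr_ae ?_
  filter_upwards [ae_gaussMeasure_mem_Ioo] with x hx
  have h1 : ∀ k : ℕ, (gaussMap ⁻¹' A).indicator (1 : ℝ → ENNReal) (1 / (k + 1 + x)) =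
      A.indicator 1 x := by
    intro k
    have := gaussMap_one_div k (Set.Ioo_subset_Ico_self hx)
    by_cases hA : x ∈ A
    · rw [Set.indicator_of_mem hA, Set.indicator_of_mem (by rwa [Set.mem_preimage, this])]
      rfl
    · rw [Set.indicator_of_notMem hA, Set.indicator_of_notMem (by rwa [Set.mem_preimage, this])]
  rw [tsum_congr fun k => congrArg (ENNReal.ofReal (gaussWeight k x) * ·) (h1 k)]
  rw [ENNReal.tsum_mul_right, ← ENNReal.ofReal_tsum_of_nonneg
    (fun k => gaussWeight_nonneg k hx.1.le) (hasSum_gaussWeight hx.1.le).summable,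
    (hasSum_gaussWeight hx.1.le).tsum_eq, ENNReal.ofReal_one, one_mul]

lemma integral_gaussTransfer_of_nonneg {H : ℝ → ℝ} (hH : Measurable H)
    (hH0 : ∀ x ∈ Set.Icc (0 : ℝ) 1, 0 ≤ H x) {C : ℝ} (hC : ∀ x ∈ Set.Icc (0 : ℝ) 1, |H x| ≤ C) :
    ∫ x, gaussTransfer H x ∂gaussMeasure = ∫ x, H x ∂gaussMeasure := by
  rw [integral_eq_lintegral_of_nonneg_ae (f := H), integral_eq_lintegral_of_nonneg_ae,
    lintegral_gaussMeasure_eq_transfer hH.ennreal_ofReal]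
  · congr 1
    refine lintegral_congr_ae ?_
    filter_upwards [ae_gaussMeasure_mem_Ioo] with x hx
    rw [gaussTransfer, ENNReal.ofReal_tsum_of_nonneg
      (fun k => mul_nonneg (gaussWeight_nonneg k hx.1.le) (hH0 _ (one_div_mem_Icc k hx.1.le)))
      (summable_gaussTransfer hC hx.1.le)]
    exact tsum_congr fun k => ENNReal.ofReal_mul (gaussWeight_nonneg k hx.1.le)
  · filter_upwards [ae_gaussMeasure_mem_Ioo] with x hx
    exact tsum_nonneg fun k =>
      mul_nonneg (gaussWeight_nonneg k hx.1.le) (hH0 _ (one_div_mem_Icc k hx.1.le))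
  · exact (measurable_gaussTransfer hH).aestronglyMeasurable
  · filter_upwards [ae_gaussMeasure_mem_Ioo] with x hx
    exact hH0 x (Set.Ioo_subset_Icc_self hx)
  · exact hH.aestronglyMeasurable

lemma integrable_gaussMeasure_of_bound {H : ℝ → ℝ} (hH : Measurable H) {C : ℝ}
    (hC : ∀ x ∈ Set.Icc (0 : ℝ) 1, |H x| ≤ C) : Integrable H gaussMeasure := by
  refine Integrable.of_bound hH.aestronglyMeasurable C ?_
  filter_upwards [ae_gaussMeasure_mem_Ioo] with x hx
  exact hC x (Set.Ioo_subset_Icc_self hx)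

lemma abs_gaussTransfer_le {H : ℝ → ℝ} {C : ℝ} (hC : ∀ x ∈ Set.Icc (0 : ℝ) 1, |H x| ≤ C) {x : ℝ}
    (hx : 0 ≤ x) : |gaussTransfer H x| ≤ C := by
  have hs := summable_gaussTransfer hC hx
  have h1 := (hasSum_gaussWeight hx).mul_right C
  rw [one_mul] at h1
  refine tsum_of_norm_bounded (f := fun k : ℕ => gaussWeight k x * H (1 / (k + 1 + x))) h1
    fun k => ?_
  rw [norm_mul, Real.norm_of_nonneg (gaussWeight_nonneg k hx), Real.norm_eq_abs]
  exact mul_le_mul_of_nonneg_left (hC _ (one_div_mem_Icc k hx)) (gaussWeight_nonneg k hx)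

lemma gaussTransfer_add_const {H : ℝ → ℝ} {C : ℝ} (hC : ∀ x ∈ Set.Icc (0 : ℝ) 1, |H x| ≤ C)
    (a : ℝ) {x : ℝ} (hx : 0 ≤ x) :
    gaussTransfer (fun y => H y + a) x = gaussTransfer H x + a := by
  have h1 := (hasSum_gaussWeight hx).mul_right a
  rw [one_mul] at h1
  have h2 := (summable_gaussTransfer hC hx).hasSum.add h1
  simp only [← mul_add] at h2
  exact h2.tsum_eq

/-- The Gauss measure is invariant under the transfer operator. -/
lemma integral_gaussTransfer {H : ℝ → ℝ} (hH : Measurable H) {C : ℝ}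
    (hC : ∀ x ∈ Set.Icc (0 : ℝ) 1, |H x| ≤ C) :
    ∫ x, gaussTransfer H x ∂gaussMeasure = ∫ x, H x ∂gaussMeasure := by
  have hi := integrable_gaussMeasure_of_bound hH hC
  have hiT := integrable_gaussMeasure_of_bound (measurable_gaussTransfer hH)
    fun x hx => abs_gaussTransfer_le hC hx.1
  -- Adding the bound `C` reduces to the nonnegative case.
  have h1 := integral_gaussTransfer_of_nonneg (hH.add_const C)
    (fun x hx => by linarith [(abs_le.1 (hC x hx)).1]) (C := C + C) (fun x hx => by
      have := abs_le.1 (hC x hx)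
      rw [abs_of_nonneg (by linarith)]
      linarith)
  have h2 : ∫ x, gaussTransfer (fun y => H y + C) x ∂gaussMeasure =
      ∫ x, (gaussTransfer H x + C) ∂gaussMeasure := by
    refine integral_congr_ae ?_
    filter_upwards [ae_gaussMeasure_mem_Ioo] with x hx
    exact gaussTransfer_add_const hC C hx.1.le
  rw [h2, integral_add hiT (integrable_const C), integral_add hi (integrable_const C)] at h1
  linarith

lemma abs_mul_le_of_abs_le_one {s : Set ℝ} {f g : ℝ → ℝ} {C : ℝ} (hC : ∀ x ∈ s, |f x| ≤ C)
    (hg1 : ∀ x, |g x| ≤ 1) : ∀ x ∈ s, |f x * g x| ≤ C := fun x hx => by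
  rw [abs_mul]
  exact (mul_le_mul (hC x hx) (hg1 x) (abs_nonneg _) ((abs_nonneg _).trans (hC x hx))).trans_eq
    (mul_one C)

lemma integral_mul_comp_gaussMap {f g : ℝ → ℝ} (hf : Measurable f) (hg : Measurable g) {C : ℝ}
    (hC : ∀ x ∈ Set.Icc (0 : ℝ) 1, |f x| ≤ C) (hg1 : ∀ x, |g x| ≤ 1) :
    ∫ x, f x * g (gaussMap x) ∂gaussMeasure = ∫ x, gaussTransfer f x * g x ∂gaussMeasure := by
  have hm : Measurable fun x => f x * g (gaussMap x) := hf.mul (hg.comp measurable_gaussMap)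
  rw [← integral_gaussTransfer hm (abs_mul_le_of_abs_le_one hC fun x => hg1 (gaussMap x))]
  refine integral_congr_ae ?_
  filter_upwards [ae_gaussMeasure_mem_Ioo] with x hx
  rw [gaussTransfer, gaussTransfer, ← tsum_mul_right]
  refine tsum_congr fun k => ?_
  simp only [gaussMap_one_div k (Set.Ioo_subset_Ico_self hx), mul_assoc]

/-- Two effects agree as `x` grows: every preimage `1/(k+1+x)` moves left, and weight moves to
larger `k`, that is, to preimages further left. -/
lemma gaussTransfer_antitoneOn {f : ℝ → ℝ} (hf : MonotoneOn f (Set.Icc 0 1))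
    (hf0 : ∀ x ∈ Set.Icc (0 : ℝ) 1, 0 ≤ f x) (hf1 : ∀ x ∈ Set.Icc (0 : ℝ) 1, |f x| ≤ 1) :
    AntitoneOn (gaussTransfer f) (Set.Icc 0 1) := by
  intro x hx y hy hxy
  set F : ℕ → ℝ := fun k => f (1 / (k + 1 + x)) with hF
  have hxk : ∀ k : ℕ, 0 < (k : ℝ) + 1 + x := fun k => by
    linarith [hx.1, (k.cast_nonneg : (0 : ℝ) ≤ k)]
  have hF0 : ∀ k, 0 ≤ F k := fun k => hf0 _ (one_div_mem_Icc k hx.1)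
  have hFanti : ∀ k, F (k + 1) ≤ F k := fun k =>
    hf (one_div_mem_Icc _ hx.1) (one_div_mem_Icc _ hx.1)
      (one_div_le_one_div_of_le (hxk k) (by push_cast; linarith))
  have hsum : ∀ n : ℕ, 0 ≤ ∑ k ∈ Finset.range n, (gaussWeight k x - gaussWeight k y) := by
    intro n
    rw [Finset.sum_sub_distrib, sum_gaussWeight n hx.1, sum_gaussWeight n hy.1, sub_nonneg]
    exact div_le_div_of_nonneg_left (Nat.cast_nonneg n) (hxk n) (by linarith)
  -- Abel summation: the partial sums of the weight differences are nonnegative and `F` decreases.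
  -- The boundary term on the left is nonnegative since `F ≥ 0`.
  have habel : ∀ n : ℕ, (∑ k ∈ Finset.range n, (gaussWeight k x - gaussWeight k y)) * F n ≤
      ∑ k ∈ Finset.range n, (gaussWeight k x - gaussWeight k y) * F k := by
    intro n
    induction n with
    | zero => simp
    | succ n ih =>
      have h1 := mul_le_mul_of_nonneg_left (hFanti n) (hsum (n + 1))
      rw [Finset.sum_range_succ (fun k => (gaussWeight k x - gaussWeight k y) * F k)]
      rw [Finset.sum_range_succ] at h1 ⊢
      linarith
  have hsy : Summable fun k => gaussWeight k y * F k := by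
    refine Summable.of_norm_bounded (hasSum_gaussWeight hy.1).summable fun k => ?_
    rw [norm_mul, Real.norm_of_nonneg (gaussWeight_nonneg k hy.1), Real.norm_eq_abs]
    exact mul_le_of_le_one_right (gaussWeight_nonneg k hy.1) (hf1 _ (one_div_mem_Icc k hx.1))
  have hsx : Summable fun k => gaussWeight k x * F k := summable_gaussTransfer hf1 hx.1
  calc gaussTransfer f y ≤ ∑' k, gaussWeight k y * F k := by
        refine (summable_gaussTransfer hf1 hy.1).tsum_le_tsum (fun k => ?_) hsy
        refine mul_le_mul_of_nonneg_left (hf (one_div_mem_Icc k hy.1) (one_div_mem_Icc k hx.1)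
          (one_div_le_one_div_of_le (hxk k) (by linarith))) (gaussWeight_nonneg k hy.1)
    _ ≤ ∑' k, gaussWeight k x * F k := by
        rw [← sub_nonneg, ← hsx.tsum_sub hsy]
        refine ge_of_tendsto' (hsx.sub hsy).hasSum.tendsto_sum_nat fun n => ?_
        refine (mul_nonneg (hsum n) (hF0 n)).trans ((habel n).trans (le_of_eq ?_))
        exact Finset.sum_congr rfl fun k _ => sub_mul _ _ _

/-- The preimages of `0` other than `1` are those of `1` under the branches, with half the weight,
so `Pf(0) = f(1)/2 + Pf(1)/2` for the transfer operator `P`. The difference is thus `(f(1) -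
Pf(1))/2`, and `Pf(1) ≥ f(0)`. -/
lemma gaussTransfer_zero_sub_one_le {f : ℝ → ℝ} (hf : MonotoneOn f (Set.Icc 0 1))
    (hf1 : ∀ x ∈ Set.Icc (0 : ℝ) 1, |f x| ≤ 1) :
    gaussTransfer f 0 - gaussTransfer f 1 ≤ 1 / 2 * (f 1 - f 0) := by
  have h0 := summable_gaussTransfer hf1 (le_refl (0 : ℝ))
  have h1 : gaussTransfer f 0 = 1 / 2 * f 1 + 1 / 2 * gaussTransfer f 1 := by
    rw [gaussTransfer, h0.tsum_eq_zero_add, gaussTransfer, ← tsum_mul_left]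
    congr 1
    · norm_num [gaussWeight]
    · refine tsum_congr fun k => ?_
      have h2 : (k : ℝ) + 1 + 1 ≠ 0 := by positivity
      have h3 : (k : ℝ) + 2 + 1 ≠ 0 := by positivity
      have h4 : (k : ℝ) + 1 + 2 ≠ 0 := by positivity
      simp only [gaussWeight, add_zero, Nat.cast_add, Nat.cast_one]
      rw [← mul_assoc]
      congr 1
      rw [show (k : ℝ) + 2 + 1 = k + 1 + 2 by ring]
      field_simp
      norm_num
  have h2 : f 0 ≤ gaussTransfer f 1 := by
    have h3 := (hasSum_gaussWeight (zero_le_one' ℝ)).mul_right (f 0)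
    rw [one_mul] at h3
    rw [← h3.tsum_eq]
    refine h3.summable.tsum_le_tsum (fun k => ?_) (summable_gaussTransfer hf1 zero_le_one)
    have h4 := one_div_mem_Icc k (zero_le_one' ℝ)
    exact mul_le_mul_of_nonneg_left (hf ⟨le_rfl, zero_le_one⟩ h4 h4.1)
      (gaussWeight_nonneg k zero_le_one)
  linarith

/-- Exponential decay of correlations of the Gauss map for monotone observables. -/
theorem abs_integral_mul_comp_gaussMap_sub_le (L : ℕ) {f g : ℝ → ℝ} (hfm : Measurable f)
    (hf : MonotoneOn f (Set.Icc 0 1)) (hf0 : ∀ x ∈ Set.Icc (0 : ℝ) 1, 0 ≤ f x)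
    (hf1 : ∀ x ∈ Set.Icc (0 : ℝ) 1, f x ≤ 1) (hg : Measurable g) (hg1 : ∀ x, |g x| ≤ 1) :
    |∫ x, f x * g (gaussMap^[L] x) ∂gaussMeasure -
      (∫ x, f x ∂gaussMeasure) * ∫ x, g x ∂gaussMeasure| ≤ (1 / 2) ^ L * (f 1 - f 0) := by
  induction L generalizing f with
  | zero =>
    have habs : ∀ x ∈ Set.Icc (0 : ℝ) 1, |f x| ≤ 1 := fun x hx => by
      rw [abs_of_nonneg (hf0 x hx)]; exact hf1 x hx
    have hfi := integrable_gaussMeasure_of_bound hfm habs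
    have hgi := integrable_gaussMeasure_of_bound hg fun x _ => hg1 x
    have hfgi : Integrable (fun x => f x * g x) gaussMeasure :=
      integrable_gaussMeasure_of_bound (hfm.mul hg) (abs_mul_le_of_abs_le_one habs hg1)
    set I := ∫ x, f x ∂gaussMeasure with hI
    have hle : ∀ᵐ x ∂gaussMeasure, f 0 ≤ f x ∧ f x ≤ f 1 := by
      filter_upwards [ae_gaussMeasure_mem_Ioo] with x hx
      exact ⟨hf ⟨le_rfl, zero_le_one⟩ (Set.Ioo_subset_Icc_self hx) hx.1.le,
        hf (Set.Ioo_subset_Icc_self hx) ⟨zero_le_one, le_rfl⟩ hx.2.le⟩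
    have hI0 : f 0 ≤ I := by
      have := integral_mono_ae (integrable_const (f 0)) hfi (hle.mono fun x hx => hx.1)
      simpa using this
    have hI1 : I ≤ f 1 := by
      have := integral_mono_ae hfi (integrable_const (f 1)) (hle.mono fun x hx => hx.2)
      simpa using this
    have h1 : ∫ x, f x * g x ∂gaussMeasure - I * ∫ x, g x ∂gaussMeasure =
        ∫ x, (f x - I) * g x ∂gaussMeasure := by
      rw [← integral_const_mul, ← integral_sub hfgi (hgi.const_mul I)]
      exact integral_congr_ae (ae_of_all _ fun x => by simp only; ring)
    simp only [Function.iterate_zero, id_eq, pow_zero, one_mul]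
    rw [h1]
    have h2 := norm_integral_le_of_norm_le_const (μ := gaussMeasure)
      (f := fun x => (f x - I) * g x) (C := f 1 - f 0) (by
        filter_upwards [hle] with x hx
        rw [norm_mul, Real.norm_eq_abs, Real.norm_eq_abs]
        have h2 : |f x - I| ≤ f 1 - f 0 :=
          abs_le.2 ⟨by linarith [hx.1, hx.2], by linarith [hx.1, hx.2]⟩
        exact (mul_le_mul h2 (hg1 x) (abs_nonneg _) ((abs_nonneg _).trans h2)).trans_eq
          (mul_one _))
    simpa using h2
  | succ L ih =>
    have habs : ∀ x ∈ Set.Icc (0 : ℝ) 1, |f x| ≤ 1 := fun x hx => by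
      rw [abs_of_nonneg (hf0 x hx)]; exact hf1 x hx
    have hT : ∀ x ∈ Set.Icc (0 : ℝ) 1, |gaussTransfer f x| ≤ 1 := fun x hx =>
      abs_gaussTransfer_le habs hx.1
    have hTm := measurable_gaussTransfer hfm
    have hT0 : ∀ x ∈ Set.Icc (0 : ℝ) 1, 0 ≤ gaussTransfer f x := fun x hx =>
      tsum_nonneg fun k => mul_nonneg (gaussWeight_nonneg k hx.1)
        (hf0 _ (one_div_mem_Icc k hx.1))
    have hgLm : Measurable fun x => g (gaussMap^[L] x) :=
      hg.comp (measurable_gaussMap.iterate L)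
    -- By duality one iterate moves onto `f`. The function `1 - Pf` is again monotone with values in
    -- `[0, 1]`; its covariances are those of `Pf` with opposite sign, and its oscillation is at
    -- most half that of `f`.
    have h1 := ih (f := fun x => 1 - gaussTransfer f x) (measurable_const.sub hTm)
      (fun x hx y hy hxy => sub_le_sub_left (gaussTransfer_antitoneOn hf hf0 habs hx hy hxy) 1)
      (fun x hx => sub_nonneg.2 (abs_le.1 (hT x hx)).2) (fun x hx => by linarith [hT0 x hx])
    have hTi := integrable_gaussMeasure_of_bound hTm hT
    have hgLi := integrable_gaussMeasure_of_bound hgLm fun x _ => hg1 _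
    have hTgi : Integrable (fun x => gaussTransfer f x * g (gaussMap^[L] x)) gaussMeasure :=
      integrable_gaussMeasure_of_bound (hTm.mul hgLm)
        (abs_mul_le_of_abs_le_one hT fun x => hg1 _)
    have h2 : ∫ x, (1 - gaussTransfer f x) * g (gaussMap^[L] x) ∂gaussMeasure =
        ∫ x, g x ∂gaussMeasure - ∫ x, f x * g (gaussMap^[L + 1] x) ∂gaussMeasure := by
      have h3 := integral_mul_comp_gaussMap hfm hgLm habs fun x => hg1 _
      have h4 : ∫ x, g (gaussMap^[L] x) ∂gaussMeasure = ∫ x, g x ∂gaussMeasure := by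
        have hp := measurePreserving_gaussMap.iterate L
        rw [← integral_map (μ := gaussMeasure) hp.measurable.aemeasurable
          hg.aestronglyMeasurable, hp.map_eq]
      simp only [Function.iterate_succ_apply]
      rw [h3, ← h4, ← integral_sub hgLi hTgi]
      exact integral_congr_ae (ae_of_all _ fun x => by simp only; ring)
    have h3 : ∫ x, (1 - gaussTransfer f x) ∂gaussMeasure = 1 - ∫ x, f x ∂gaussMeasure := by
      rw [integral_sub (integrable_const 1) hTi, integral_gaussTransfer hfm habs]
      simp
    rw [h2, h3] at h1
    have h4 := gaussTransfer_zero_sub_one_le hf habs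
    have h5 : (0 : ℝ) < (1 / 2) ^ L := by positivity
    rw [abs_sub_comm] at h1
    calc _ = _ := by congr 1; ring
      _ ≤ _ := h1
      _ = (1 / 2) ^ L * (gaussTransfer f 0 - gaussTransfer f 1) := by ring
      _ ≤ (1 / 2) ^ L * (1 / 2 * (f 1 - f 0)) := mul_le_mul_of_nonneg_left h4 h5.le
      _ = _ := by ring

end GaussMap

/-! ### Moments of the autocorrelations of the hits -/

section Variance

/-- The centred indicator function of the interval `(0, t)` with respect to the Gauss measure. -/
noncomputable def centredIndicator (t z : ℝ) : ℝ :=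
  (Set.Ioo 0 t).indicator 1 z - gaussMeasure.real (Set.Ioo 0 t)

lemma measurable_indicator_Ioo (t : ℝ) : Measurable ((Set.Ioo 0 t).indicator (1 : ℝ → ℝ)) :=
  measurable_one.indicator measurableSet_Ioo

lemma measurable_centredIndicator (t : ℝ) : Measurable (centredIndicator t) :=
  (measurable_indicator_Ioo t).sub_const _

lemma indicator_Ioo_nonneg (t z : ℝ) : 0 ≤ (Set.Ioo 0 t).indicator (1 : ℝ → ℝ) z :=
  Set.indicator_nonneg (fun _ _ => zero_le_one) z

lemma indicator_Ioo_le_one (t z : ℝ) : (Set.Ioo 0 t).indicator (1 : ℝ → ℝ) z ≤ 1 :=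
  Set.indicator_le' (fun _ _ => le_rfl) (fun _ _ => zero_le_one) z

lemma abs_indicator_Ioo_le (t z : ℝ) : |(Set.Ioo 0 t).indicator (1 : ℝ → ℝ) z| ≤ 1 :=
  abs_le.2 ⟨by linarith [indicator_Ioo_nonneg t z], indicator_Ioo_le_one t z⟩

lemma abs_centredIndicator_le (t z : ℝ) : |centredIndicator t z| ≤ 1 := by
  have h1 := indicator_Ioo_nonneg t z
  have h2 := indicator_Ioo_le_one t z
  have h3 : 0 ≤ gaussMeasure.real (Set.Ioo 0 t) := measureReal_nonneg
  have h4 : gaussMeasure.real (Set.Ioo 0 t) ≤ 1 := measureReal_le_one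
  exact abs_le.2 ⟨by unfold centredIndicator; linarith, by unfold centredIndicator; linarith⟩

lemma abs_centredIndicator_le_add (t z : ℝ) : |centredIndicator t z| ≤
    (Set.Ioo 0 t).indicator 1 z + gaussMeasure.real (Set.Ioo 0 t) := by
  refine (abs_sub _ _).trans (le_of_eq ?_)
  rw [abs_of_nonneg (indicator_Ioo_nonneg t z), abs_of_nonneg measureReal_nonneg]

lemma integrable_gaussMeasure {H : ℝ → ℝ} (hH : Measurable H) {C : ℝ} (hC : ∀ x, |H x| ≤ C) :
    Integrable H gaussMeasure :=
  integrable_gaussMeasure_of_bound hH fun x _ => hC x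

lemma integral_indicator_Ioo (t : ℝ) : ∫ z, (Set.Ioo 0 t).indicator (1 : ℝ → ℝ) z ∂gaussMeasure =
    gaussMeasure.real (Set.Ioo 0 t) :=
  integral_indicator_one measurableSet_Ioo

lemma integral_comp_gaussMap_iterate {g : ℝ → ℝ} (hg : Measurable g) (n : ℕ) :
    ∫ y, g (gaussMap^[n] y) ∂gaussMeasure = ∫ y, g y ∂gaussMeasure := by
  have hp := measurePreserving_gaussMap.iterate n
  rw [← integral_map (μ := gaussMeasure) hp.measurable.aemeasurable hg.aestronglyMeasurable,
    hp.map_eq]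

/-- Almost everywhere `1_(0,t) = 1 - 1_[t,∞)`, and the latter indicator is monotone with oscillation
at most `1`. No regularity of `g` is needed, so `g` may collect any number of later hits. -/
lemma abs_integral_centredIndicator_mul_le (t : ℝ) (L : ℕ) {g : ℝ → ℝ} (hg : Measurable g)
    (hg1 : ∀ x, |g x| ≤ 1) :
    |∫ z, centredIndicator t z * g (gaussMap^[L] z) ∂gaussMeasure| ≤ (1 / 2) ^ L := by
  set f : ℝ → ℝ := (Set.Ici t).indicator 1 with hf
  have hfm : Measurable f := measurable_one.indicator measurableSet_Ici
  have hf0 : ∀ x, 0 ≤ f x := fun x => Set.indicator_nonneg (fun _ _ => zero_le_one) x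
  have hf1 : ∀ x, f x ≤ 1 := fun x =>
    Set.indicator_le' (fun _ _ => le_rfl) (fun _ _ => zero_le_one) x
  have hmono : Monotone f := by
    intro x y hxy
    by_cases hx : x ∈ Set.Ici t
    · have hy : y ∈ Set.Ici t := le_trans hx hxy
      rw [hf, Set.indicator_of_mem hx, Set.indicator_of_mem hy]
      rfl
    · rw [hf, Set.indicator_of_notMem hx]
      exact hf0 y
  have hgL : Measurable fun z => g (gaussMap^[L] z) := hg.comp (measurable_gaussMap.iterate L)
  have h1 := abs_integral_mul_comp_gaussMap_sub_le L hfm (hmono.monotoneOn _) (fun x _ => hf0 x)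
    (fun x _ => hf1 x) hg hg1
  have hfi : Integrable f gaussMeasure :=
    integrable_gaussMeasure hfm fun x => by rw [abs_of_nonneg (hf0 x)]; exact hf1 x
  have hgi : Integrable (fun z => g (gaussMap^[L] z)) gaussMeasure :=
    integrable_gaussMeasure hgL fun x => hg1 _
  have hfgi : Integrable (fun z => f z * g (gaussMap^[L] z)) gaussMeasure :=
    integrable_gaussMeasure (hfm.mul hgL) fun x => abs_mul_le_of_abs_le_one (s := Set.univ)
      (fun x _ => by rw [abs_of_nonneg (hf0 x)]; exact hf1 x) (fun x => hg1 (gaussMap^[L] x)) x trivial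
  have hae : ∀ᵐ z ∂gaussMeasure, (Set.Ioo 0 t).indicator (1 : ℝ → ℝ) z = 1 - f z := by
    filter_upwards [ae_gaussMeasure_mem_Ioo] with z hz
    by_cases hzt : z < t
    · rw [Set.indicator_of_mem (show z ∈ Set.Ioo 0 t from ⟨hz.1, hzt⟩), hf,
        Set.indicator_of_notMem (show z ∉ Set.Ici t from not_le.2 hzt), sub_zero]
      rfl
    · rw [Set.indicator_of_notMem (show z ∉ Set.Ioo 0 t from fun h => hzt h.2), hf,
        Set.indicator_of_mem (show z ∈ Set.Ici t from not_lt.1 hzt)]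
      simp
  have hint : gaussMeasure.real (Set.Ioo 0 t) = 1 - ∫ z, f z ∂gaussMeasure := by
    rw [← integral_indicator_Ioo, integral_congr_ae hae,
      integral_sub (integrable_const 1) hfi]
    simp
  have h2 : ∫ z, centredIndicator t z * g (gaussMap^[L] z) ∂gaussMeasure =
      (∫ z, f z ∂gaussMeasure) * ∫ z, g z ∂gaussMeasure -
        ∫ z, f z * g (gaussMap^[L] z) ∂gaussMeasure := by
    rw [← integral_comp_gaussMap_iterate hg L, ← integral_const_mul,
      ← integral_sub (hgi.const_mul _) hfgi]
    refine integral_congr_ae ?_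
    filter_upwards [hae] with z hz
    rw [centredIndicator, hz, hint]
    ring
  rw [h2, abs_sub_comm]
  refine h1.trans ?_
  have h3 : f 1 - f 0 ≤ 1 := by linarith [hf0 0, hf1 1]
  exact mul_le_of_le_one_right (by positivity) h3

variable (t : ℕ → ℝ)

/-- The centred indicator of the event that the `n`-th iterate hits `(0, t n)`. -/
noncomputable def centredHit (n : ℕ) (y : ℝ) : ℝ := centredIndicator (t n) (gaussMap^[n] y)

lemma measurable_centredHit (n : ℕ) : Measurable (centredHit t n) :=
  (measurable_centredIndicator _).comp (measurable_gaussMap.iterate n)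

lemma abs_centredHit_le (n : ℕ) (y : ℝ) : |centredHit t n y| ≤ 1 := abs_centredIndicator_le _ _

lemma abs_centredHit_mul_le (m n : ℕ) (y : ℝ) : |centredHit t m y * centredHit t n y| ≤ 1 := by
  rw [abs_mul]
  exact mul_le_one₀ (abs_centredHit_le t m y) (abs_nonneg _) (abs_centredHit_le t n y)

lemma abs_integral_centredHit_mul_le (n L : ℕ) {g : ℝ → ℝ} (hg : Measurable g)
    (hg1 : ∀ x, |g x| ≤ 1) :
    |∫ y, centredHit t n y * g (gaussMap^[n + L] y) ∂gaussMeasure| ≤ (1 / 2) ^ L := by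
  have hm : Measurable fun z => centredIndicator (t n) z * g (gaussMap^[L] z) :=
    (measurable_centredIndicator _).mul (hg.comp (measurable_gaussMap.iterate L))
  have h1 := integral_comp_gaussMap_iterate hm n
  simp only [← Function.iterate_add_apply] at h1
  simp only [centredHit, Nat.add_comm n L]
  rw [h1]
  exact abs_integral_centredIndicator_mul_le (t n) L hg hg1

lemma centredHit_eq_comp {k m : ℕ} (h : k ≤ m) (y : ℝ) :
    centredHit t m y = centredIndicator (t m) (gaussMap^[m - k] (gaussMap^[k] y)) := by
  rw [centredHit, ← Function.iterate_add_apply, Nat.sub_add_cancel h]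

/-- The earliest factor has mean zero, and the other three form one bounded function of the orbit
from time `n + L` on. -/
lemma abs_integral_centredHit_four_le {n m h L : ℕ} (hh : L ≤ h) (hm : n + L ≤ m) :
    |∫ y, centredHit t n y * centredHit t (n + h) y *
      (centredHit t m y * centredHit t (m + h) y) ∂gaussMeasure| ≤ (1 / 2) ^ L := by
  set ψ : ℕ → ℝ → ℝ := fun j z => centredIndicator (t j) (gaussMap^[j - (n + L)] z) with hψ
  have hψm : ∀ j, Measurable (ψ j) := fun j =>
    (measurable_centredIndicator _).comp (measurable_gaussMap.iterate _)
  have hψ1 : ∀ j z, |ψ j z| ≤ 1 := fun j z => abs_centredIndicator_le _ _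
  have h1 := abs_integral_centredHit_mul_le t n L
    (g := fun z => ψ (n + h) z * (ψ m z * ψ (m + h) z))
    ((hψm _).mul ((hψm _).mul (hψm _))) (fun z => by
      rw [abs_mul, abs_mul]
      exact mul_le_one₀ (hψ1 _ _) (by positivity) (mul_le_one₀ (hψ1 _ _) (abs_nonneg _) (hψ1 _ _)))
  refine le_trans (le_of_eq ?_) h1
  congr 1
  refine integral_congr_ae (ae_of_all _ fun y => ?_)
  simp only [hψ, ← centredHit_eq_comp t (show n + L ≤ n + h by omega),
    ← centredHit_eq_comp t hm, ← centredHit_eq_comp t (show n + L ≤ m + h by omega)]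
  ring

/-- The probability that the `n`-th iterate hits `(0, t n)`. -/
noncomputable def hitProb (n : ℕ) : ℝ := gaussMeasure.real (Set.Ioo 0 (t n))

lemma hitProb_nonneg (n : ℕ) : 0 ≤ hitProb t n := measureReal_nonneg

lemma integral_hit (n : ℕ) :
    ∫ y, (Set.Ioo 0 (t n)).indicator (1 : ℝ → ℝ) (gaussMap^[n] y) ∂gaussMeasure = hitProb t n := by
  rw [integral_comp_gaussMap_iterate (measurable_indicator_Ioo (t n)) n, integral_indicator_Ioo,
    hitProb]

lemma integrable_hit (n : ℕ) :
    Integrable (fun y => (Set.Ioo 0 (t n)).indicator (1 : ℝ → ℝ) (gaussMap^[n] y)) gaussMeasure :=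
  integrable_gaussMeasure ((measurable_indicator_Ioo _).comp (measurable_gaussMap.iterate n))
    fun _ => abs_indicator_Ioo_le _ _

lemma integrable_centredHit_mul (m n : ℕ) :
    Integrable (fun y => centredHit t m y * centredHit t n y) gaussMeasure :=
  integrable_gaussMeasure ((measurable_centredHit t m).mul (measurable_centredHit t n))
    (abs_centredHit_mul_le t m n)

lemma integral_abs_centredHit_mul_le (m n : ℕ) :
    ∫ y, |centredHit t m y * centredHit t n y| ∂gaussMeasure ≤ 2 * hitProb t m := by
  have h1 : ∫ y, |centredHit t m y * centredHit t n y| ∂gaussMeasure ≤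
      ∫ y, ((Set.Ioo 0 (t m)).indicator (1 : ℝ → ℝ) (gaussMap^[m] y) + hitProb t m)
        ∂gaussMeasure := by
    refine integral_mono (integrable_centredHit_mul t m n).abs
      ((integrable_hit t m).add (integrable_const _)) fun y => ?_
    simp only [abs_mul]
    exact (mul_le_of_le_one_right (abs_nonneg _) (abs_centredHit_le t n y)).trans
      (abs_centredIndicator_le_add _ _)
  rw [integral_add (integrable_hit t m) (integrable_const _), integral_hit] at h1
  simpa [two_mul] using h1

/-- With `Y` the uncentred hit, expand `(Y n + σ n)(Y (n+h) + σ (n+h))` and write `Y n = c n + σ n`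
in the leading product. The term `c n · Y (n+h)` decays; the others have total mean `4 σ n σ (n+h)`.
-/
lemma integral_abs_centredHit_mul_shift_le {n h L : ℕ} (hh : L ≤ h) :
    ∫ y, |centredHit t n y * centredHit t (n + h) y| ∂gaussMeasure ≤
      4 * (hitProb t n * hitProb t (n + h)) + (1 / 2) ^ L := by
  set Y : ℕ → ℝ → ℝ := fun j y => (Set.Ioo 0 (t j)).indicator (1 : ℝ → ℝ) (gaussMap^[j] y) with hY
  set σ := hitProb t
  have hYm : ∀ j, Measurable (Y j) := fun j =>
    (measurable_indicator_Ioo _).comp (measurable_gaussMap.iterate j)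
  have hcY : Integrable (fun y => centredHit t n y * Y (n + h) y) gaussMeasure :=
    integrable_gaussMeasure ((measurable_centredHit t n).mul (hYm _)) fun y =>
      abs_mul_le_of_abs_le_one (s := Set.univ) (fun y _ => abs_centredHit_le t n y)
        (fun y => abs_indicator_Ioo_le _ _) y trivial
  have h1 : ∫ y, centredHit t n y * Y (n + h) y ∂gaussMeasure ≤ (1 / 2) ^ L := by
    have h2 := abs_integral_centredHit_mul_le t n L
      (g := fun z => (Set.Ioo 0 (t (n + h))).indicator (1 : ℝ → ℝ) (gaussMap^[h - L] z))
      ((measurable_indicator_Ioo _).comp (measurable_gaussMap.iterate _))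
      (fun z => abs_indicator_Ioo_le _ _)
    simp only [← Function.iterate_add_apply, show h - L + (n + L) = n + h by omega] at h2
    exact (le_abs_self _).trans h2
  have hi1 : Integrable (fun y => σ (n + h) * Y n y) gaussMeasure :=
    (integrable_hit t n).const_mul _
  have hi2 : Integrable (fun y => 2 * σ n * Y (n + h) y) gaussMeasure :=
    (integrable_hit t (n + h)).const_mul _
  have hi3 : Integrable (fun y => centredHit t n y * Y (n + h) y + 2 * σ n * Y (n + h) y)
      gaussMeasure := hcY.add hi2
  have hi4 : Integrable (fun y => centredHit t n y * Y (n + h) y + 2 * σ n * Y (n + h) y +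
      σ (n + h) * Y n y) gaussMeasure := hi3.add hi1
  have h3 : ∫ y, |centredHit t n y * centredHit t (n + h) y| ∂gaussMeasure ≤
      ∫ y, (centredHit t n y * Y (n + h) y + 2 * σ n * Y (n + h) y + σ (n + h) * Y n y +
        σ n * σ (n + h)) ∂gaussMeasure := by
    refine integral_mono (integrable_centredHit_mul t n (n + h)).abs
      (hi4.add (integrable_const _)) fun y => ?_
    have h4 : |centredHit t n y| ≤ Y n y + σ n := abs_centredIndicator_le_add _ _
    have h5 : |centredHit t (n + h) y| ≤ Y (n + h) y + σ (n + h) :=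
      abs_centredIndicator_le_add _ _
    have h6 : centredHit t n y = Y n y - σ n := rfl
    have h7 := mul_le_mul h4 h5 (abs_nonneg _) ((abs_nonneg _).trans h4)
    simp only [abs_mul, h6] at h7 ⊢
    linarith
  rw [integral_add hi4 (integrable_const _), integral_add hi3 hi1,
    integral_add hcY hi2, integral_const_mul, integral_const_mul, integral_hit, integral_hit] at h3
  simp only [integral_const, probReal_univ, smul_eq_mul, one_mul] at h3
  linarith

lemma integral_centredHit_four_le_of_shift {n m h L : ℕ} (hh : L ≤ h) :
    ∫ y, centredHit t n y * centredHit t (n + h) y *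
      (centredHit t m y * centredHit t (m + h) y) ∂gaussMeasure ≤
      4 * (hitProb t n * hitProb t (n + h)) + (1 / 2) ^ L := by
  refine le_trans ?_ (integral_abs_centredHit_mul_shift_le t hh)
  refine integral_mono ?_ (integrable_centredHit_mul t n (n + h)).abs fun y => ?_
  · exact integrable_gaussMeasure
      (((measurable_centredHit t _).mul (measurable_centredHit t _)).mul
        ((measurable_centredHit t _).mul (measurable_centredHit t _))) fun y =>
      abs_mul_le_of_abs_le_one (s := Set.univ) (fun y _ => abs_centredHit_mul_le t n (n + h) y)
        (abs_centredHit_mul_le t m (m + h)) y trivial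
  · refine (le_abs_self _).trans ?_
    rw [abs_mul]
    exact mul_le_of_le_one_right (abs_nonneg _) (abs_centredHit_mul_le t m (m + h) y)

/-- Expand the square. Pairs at distance at least `L` contribute at most `2^(-L)`; each `n` has at
most `2L` closer partners, each contributing at most a further `4 σ n ²`. The hypothesis replaces
monotonicity, which fails at `n = 0`. -/
lemma integral_sq_autocorrelation_le (hσ : ∀ n h, hitProb t n * hitProb t (n + h) ≤ hitProb t n ^ 2)
    {h L : ℕ} (hh : L ≤ h) (M : ℕ) :
    ∫ y, (∑ n ∈ Finset.range M, centredHit t n y * centredHit t (n + h) y) ^ 2 ∂gaussMeasure ≤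
      M ^ 2 * (1 / 2) ^ L + 8 * L * ∑ n ∈ Finset.range M, hitProb t n ^ 2 := by
  have hint : ∀ n m, Integrable (fun y => centredHit t n y * centredHit t (n + h) y *
      (centredHit t m y * centredHit t (m + h) y)) gaussMeasure := fun n m =>
    integrable_gaussMeasure
      (((measurable_centredHit t _).mul (measurable_centredHit t _)).mul
        ((measurable_centredHit t _).mul (measurable_centredHit t _))) fun y =>
      abs_mul_le_of_abs_le_one (s := Set.univ) (fun y _ => abs_centredHit_mul_le t n (n + h) y)
        (abs_centredHit_mul_le t m (m + h)) y trivial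
  simp_rw [sq (∑ n ∈ Finset.range M, centredHit t n _ * centredHit t (n + h) _),
    Finset.sum_mul_sum]
  rw [integral_finsetSum _ fun n _ => integrable_finsetSum _ fun m _ => hint n m]
  simp_rw [integral_finsetSum _ fun m _ => hint _ m]
  have h1 : ∀ n m, ∫ y, centredHit t n y * centredHit t (n + h) y *
      (centredHit t m y * centredHit t (m + h) y) ∂gaussMeasure ≤
      (1 / 2) ^ L + if m ∈ Finset.Ico (n - L) (n + L) then 4 * hitProb t n ^ 2 else 0 := by
    intro n m
    split_ifs with hm
    · linarith [integral_centredHit_four_le_of_shift t (n := n) (m := m) hh, hσ n h]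
    · rw [add_zero]
      rw [Finset.mem_Ico, not_and_or, not_le, not_lt] at hm
      rcases hm with hm | hm
      · have h2 := abs_integral_centredHit_four_le t (n := m) (m := n) hh (by omega)
        refine (le_abs_self _).trans (le_trans (le_of_eq ?_) h2)
        congr 1
        exact integral_congr_ae (ae_of_all _ fun y => mul_comm _ _)
      · exact (le_abs_self _).trans (abs_integral_centredHit_four_le t hh hm)
  have h2 : ∀ n, ∑ m ∈ Finset.range M,
      (if m ∈ Finset.Ico (n - L) (n + L) then 4 * hitProb t n ^ 2 else 0) ≤
      8 * L * hitProb t n ^ 2 := by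
    intro n
    rw [← Finset.sum_filter, Finset.sum_const, nsmul_eq_mul]
    have h3 : ((Finset.range M).filter fun m => m ∈ Finset.Ico (n - L) (n + L)).card ≤ 2 * L := by
      refine (Finset.card_le_card (t := Finset.Ico (n - L) (n + L)) fun m hm =>
        (Finset.mem_filter.1 hm).2).trans ?_
      rw [Nat.card_Ico]
      omega
    have h4 : (((Finset.range M).filter fun m => m ∈ Finset.Ico (n - L) (n + L)).card : ℝ) ≤
        2 * L := by exact_mod_cast h3
    nlinarith [sq_nonneg (hitProb t n)]
  calc _ ≤ ∑ n ∈ Finset.range M, ∑ m ∈ Finset.range M, ((1 / 2 : ℝ) ^ L +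
        if m ∈ Finset.Ico (n - L) (n + L) then 4 * hitProb t n ^ 2 else 0) :=
        Finset.sum_le_sum fun n _ => Finset.sum_le_sum fun m _ => h1 n m
    _ ≤ ∑ n ∈ Finset.range M, (M * (1 / 2 : ℝ) ^ L + 8 * L * hitProb t n ^ 2) := by
        refine Finset.sum_le_sum fun n _ => ?_
        rw [Finset.sum_add_distrib, Finset.sum_const, Finset.card_range, nsmul_eq_mul]
        linarith [h2 n]
    _ = _ := by
        rw [Finset.sum_add_distrib, Finset.sum_const, Finset.card_range, nsmul_eq_mul,
          ← Finset.mul_sum]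
        ring

lemma integrable_autocorrelation (h M : ℕ) : Integrable (fun y =>
    ∑ n ∈ Finset.range M, centredHit t n y * centredHit t (n + h) y) gaussMeasure :=
  integrable_finsetSum _ fun n _ => integrable_centredHit_mul t n (n + h)

lemma integrable_autocorrelationSum (N : ℕ) :
    Integrable (fun y => autocorrelationSum (fun n => centredHit t n y) N) gaussMeasure :=
  integrable_finsetSum _ fun h _ => (integrable_autocorrelation t h (N - h)).abs

/-- The expectation of the sum of autocorrelations of the centred hits. -/
theorem integral_autocorrelationSum_le
    (hσ : ∀ n h, hitProb t n * hitProb t (n + h) ≤ hitProb t n ^ 2) (N L : ℕ) {x : ℝ}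
    (hx : 0 < x) :
    ∫ y, autocorrelationSum (fun n => centredHit t n y) N ∂gaussMeasure ≤
      2 * L * ∑ n ∈ Finset.range N, hitProb t n +
      N * (x + (N ^ 2 * (1 / 2) ^ L + 8 * L * ∑ n ∈ Finset.range N, hitProb t n ^ 2) / x) := by
  set W := ∑ n ∈ Finset.range N, hitProb t n with hW
  set V := ∑ n ∈ Finset.range N, hitProb t n ^ 2 with hV
  have hW0 : 0 ≤ W := Finset.sum_nonneg fun n _ => hitProb_nonneg t n
  have hV0 : 0 ≤ V := Finset.sum_nonneg fun n _ => sq_nonneg _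
  set R := x + (N ^ 2 * (1 / 2) ^ L + 8 * L * V) / x with hR
  have hR0 : 0 ≤ R := by positivity
  have hsub : ∀ h, Finset.range (N - h) ⊆ Finset.range N := fun h =>
    Finset.range_mono (Nat.sub_le N h)
  -- Lags below `L` are bounded termwise in mean; longer lags use the second moment.
  have hterm : ∀ h, ∫ y, |∑ n ∈ Finset.range (N - h), centredHit t n y * centredHit t (n + h) y|
      ∂gaussMeasure ≤ (if h ∈ Finset.range L then 2 * W else 0) + R := by
    intro h
    split_ifs with hL
    · have h1 : ∫ y, |∑ n ∈ Finset.range (N - h), centredHit t n y * centredHit t (n + h) y|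
          ∂gaussMeasure ≤
          ∫ y, ∑ n ∈ Finset.range (N - h), |centredHit t n y * centredHit t (n + h) y|
          ∂gaussMeasure :=
        integral_mono (integrable_autocorrelation t h _).abs
          (integrable_finsetSum _ fun n _ => (integrable_centredHit_mul t n (n + h)).abs)
          fun y => Finset.abs_sum_le_sum_abs _ _
      rw [integral_finsetSum _ fun n _ => (integrable_centredHit_mul t n (n + h)).abs] at h1
      have h2 : ∑ n ∈ Finset.range (N - h), ∫ y, |centredHit t n y * centredHit t (n + h) y|
          ∂gaussMeasure ≤ ∑ n ∈ Finset.range (N - h), 2 * hitProb t n :=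
        Finset.sum_le_sum fun n _ => integral_abs_centredHit_mul_le t n (n + h)
      rw [← Finset.mul_sum] at h2
      have h3 : ∑ n ∈ Finset.range (N - h), hitProb t n ≤ W :=
        Finset.sum_le_sum_of_subset_of_nonneg (hsub h) fun n _ _ => hitProb_nonneg t n
      linarith
    · rw [zero_add]
      have hLh : L ≤ h := by simpa using hL
      set D : ℝ → ℝ := fun y =>
        ∑ n ∈ Finset.range (N - h), centredHit t n y * centredHit t (n + h) y with hD
      have hDi : Integrable D gaussMeasure := integrable_autocorrelation t h _
      have hDb : ∀ y, |D y| ≤ (N - h : ℕ) := fun y => by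
        refine (Finset.abs_sum_le_sum_abs _ _).trans
          ((Finset.sum_le_sum fun n _ => abs_centredHit_mul_le t n (n + h) y).trans ?_)
        simp
      have hDm : Measurable D := Finset.measurable_sum _ fun n _ =>
        (measurable_centredHit t _).mul (measurable_centredHit t _)
      have hD2i : Integrable (fun y => D y ^ 2) gaussMeasure :=
        integrable_gaussMeasure (hDm.pow_const 2) (C := ((N - h : ℕ) : ℝ) ^ 2) fun y => by
          rw [abs_pow]
          exact pow_le_pow_left₀ (abs_nonneg _) (hDb y) 2
      -- The inequality `|D| ≤ x + D²/x` stands in for Cauchy–Schwarz; `x` will be of the order of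
      -- the standard deviation bound, up to a power of `L`.
      have h1 : ∫ y, |D y| ∂gaussMeasure ≤ ∫ y, (x + D y ^ 2 / x) ∂gaussMeasure := by
        refine integral_mono hDi.abs ((integrable_const x).add (hD2i.div_const x)) fun y => ?_
        have h2 : |D y| = (|D y| * x) / x := by field_simp
        have h3 : x + D y ^ 2 / x = (x ^ 2 + |D y| ^ 2) / x := by
          rw [sq_abs]; field_simp
        simp only
        rw [h2, h3]
        refine div_le_div_of_nonneg_right ?_ hx.le
        nlinarith [sq_nonneg (|D y| - x), sq_nonneg x, sq_nonneg |D y|]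
      rw [integral_add (integrable_const x) (hD2i.div_const x), integral_div] at h1
      simp only [integral_const, probReal_univ, smul_eq_mul, one_mul] at h1
      refine h1.trans (add_le_add_right (div_le_div_of_nonneg_right ?_ hx.le) x)
      refine (integral_sq_autocorrelation_le t hσ hLh (N - h)).trans (add_le_add ?_ ?_)
      · have : ((N - h : ℕ) : ℝ) ≤ N := by exact_mod_cast Nat.sub_le N h
        gcongr
      · exact mul_le_mul_of_nonneg_left (Finset.sum_le_sum_of_subset_of_nonneg (hsub h)
          fun n _ _ => sq_nonneg _) (by positivity)
  unfold autocorrelationSum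
  rw [integral_finsetSum _ fun h _ => (integrable_autocorrelation t h (N - h)).abs]
  refine (Finset.sum_le_sum fun h _ => hterm h).trans ?_
  rw [Finset.sum_add_distrib, Finset.sum_const, Finset.card_range, nsmul_eq_mul]
  refine add_le_add_left ?_ _
  rw [← Finset.sum_filter, Finset.sum_const, nsmul_eq_mul]
  have h1 : ((Finset.range N).filter fun h => h ∈ Finset.range L).card ≤ L := by
    refine (Finset.card_le_card (t := Finset.range L) fun m hm =>
      (Finset.mem_filter.1 hm).2).trans (Finset.card_range L).le
  have h2 : (((Finset.range N).filter fun h => h ∈ Finset.range L).card : ℝ) ≤ L := by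
    exact_mod_cast h1
  nlinarith

end Variance

/-! ### Elementary growth estimates -/

section Rates

lemma sum_rpow_neg_le {s : ℝ} (hs0 : 0 < s) (hs1 : s < 1) (N : ℕ) :
    ∑ n ∈ Finset.range N, (n : ℝ) ^ (-s) ≤ (N : ℝ) ^ (1 - s) / (1 - s) := by
  have h1s : 0 < 1 - s := sub_pos.2 hs1
  have key : ∀ N : ℕ, ∑ n ∈ Finset.range (N + 1), (n : ℝ) ^ (-s) ≤
      (N : ℝ) ^ (1 - s) / (1 - s) := by
    intro N
    induction N with
    | zero => simp [Real.zero_rpow (neg_ne_zero.2 hs0.ne'), Real.zero_rpow h1s.ne']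
    | succ N ih =>
      rw [Finset.sum_range_succ]
      have hN : (0 : ℝ) < ((N + 1 : ℕ) : ℝ) := by positivity
      set y : ℝ := ((N + 1 : ℕ) : ℝ) with hy
      have h2 : (N : ℝ) = y * (1 + -1 / y) := by
        rw [mul_add, mul_one, mul_div_cancel₀ _ hN.ne', hy]
        push_cast
        ring
      have hy1 : 1 ≤ y := by rw [hy]; exact_mod_cast Nat.succ_pos N
      have h3 : -1 ≤ -1 / y := by
        rw [le_div_iff₀ hN]
        linarith
      -- Bernoulli's inequality for exponents in `[0, 1]`, at `-1/y`, bounds the new term by the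
      -- increment of `y^(1-s)/(1-s)`.
      have h4 := rpow_one_add_le_one_add_mul_self h3 h1s.le (by linarith : 1 - s ≤ 1)
      have h5 : (N : ℝ) ^ (1 - s) ≤ y ^ (1 - s) * (1 + (1 - s) * (-1 / y)) := by
        rw [h2, Real.mul_rpow hN.le (by linarith)]
        exact mul_le_mul_of_nonneg_left h4 (Real.rpow_nonneg hN.le _)
      have h6 : y ^ (1 - s) = y * y ^ (-s) := by
        rw [sub_eq_add_neg, Real.rpow_add hN, Real.rpow_one]
      rw [h6] at h5 ⊢
      rw [le_div_iff₀ h1s] at ih ⊢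
      have h7 : y * y ^ (-s) * (1 + (1 - s) * (-1 / y)) =
          y * y ^ (-s) - (1 - s) * y ^ (-s) := by
        field_simp
        ring
      rw [h7] at h5
      linarith
  refine le_trans ?_ (key N)
  rw [Finset.sum_range_succ]
  exact le_add_of_nonneg_right (Real.rpow_nonneg N.cast_nonneg _)

/-- The new terms are at most `σ M`, and `(M-1) σ M` is at most the old sum; `M ≤ 2(M-1)` yields the
factor `2`. -/
lemma ratio_sum_sub_one_le {σ : ℕ → ℝ} (hσ0 : ∀ n, 0 ≤ σ n) (hσ : Antitone fun n => σ (n + 1))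
    {M N : ℕ} (hM : 2 ≤ M) (hMN : M ≤ N) (hW : 0 < ∑ n ∈ Finset.range M, σ n) :
    (∑ n ∈ Finset.range N, σ n) / (∑ n ∈ Finset.range M, σ n) - 1 ≤ 2 * ((N : ℝ) / M - 1) := by
  have hM' : (2 : ℝ) ≤ M := by exact_mod_cast hM
  have hMN' : (M : ℝ) ≤ N := by exact_mod_cast hMN
  have hanti : ∀ m n, 1 ≤ m → m ≤ n → σ n ≤ σ m := fun m n h1 h2 => by
    have := hσ (show m - 1 ≤ n - 1 by omega)
    simpa only [Nat.sub_add_cancel h1, Nat.sub_add_cancel (h1.trans h2)] using this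
  have h1 : ∑ n ∈ Finset.range N, σ n ≤ ∑ n ∈ Finset.range M, σ n + (N - M) * σ M := by
    rw [← Finset.sum_range_add_sum_Ico _ hMN]
    have h2 := Finset.sum_le_card_nsmul (Finset.Ico M N) σ (σ M) fun n hn =>
      hanti M n (by omega) (Finset.mem_Ico.1 hn).1
    rw [Nat.card_Ico, nsmul_eq_mul, Nat.cast_sub hMN] at h2
    linarith
  have h2 : (M - 1) * σ M ≤ ∑ n ∈ Finset.range M, σ n := by
    rw [Finset.range_eq_Ico, Finset.sum_eq_sum_Ico_succ_bot (by omega)]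
    have h3 := Finset.card_nsmul_le_sum (Finset.Ico 1 M) σ (σ M) fun n hn =>
      hanti n M (Finset.mem_Ico.1 hn).1 (Finset.mem_Ico.1 hn).2.le
    rw [Nat.card_Ico, nsmul_eq_mul, Nat.cast_sub (by omega)] at h3
    push_cast at h3
    linarith [hσ0 0]
  rw [div_sub_one hW.ne', div_le_iff₀ hW, div_sub_one (by positivity), ← mul_div_assoc,
    div_mul_eq_mul_div, le_div_iff₀ (by positivity)]
  have h3 : M * σ M ≤ 2 * ∑ n ∈ Finset.range M, σ n := by nlinarith [hσ0 M]
  have h4 := mul_le_mul_of_nonneg_left h3 (sub_nonneg.2 hMN')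
  nlinarith

/-- In the application `m` is the gap `L`, `s = √N`, `x = N^(1/2-a)`, and `C'` bounds `N² 2^(-L)`.
Both contributions are `O(m/x)`, and `x ≥ m³` makes this `O(1/m²)`. -/
lemma div_sq_le_of_rate {m x s W V c C C' E : ℝ} (hm : 1 ≤ m) (hx : m ^ 3 ≤ x) (hs : 1 ≤ s)
    (hc : 0 < c) (hC : 0 ≤ C) (hC' : 0 ≤ C') (hW : c * (s * x) ≤ W) (hV : V ≤ C * x ^ 2)
    (hE : E ≤ 2 * m * W + s ^ 2 * (x + (C' + 8 * m * V) / x)) :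
    E / W ^ 2 ≤ (2 / c + (1 + C' + 8 * C) / c ^ 2) * (1 / m ^ 2) := by
  have hm0 : 0 < m := by linarith
  have hx0 : 0 < x := lt_of_lt_of_le (by positivity) hx
  have hx1 : 1 ≤ x := le_trans (one_le_pow₀ hm) hx
  have hs0 : 0 < s := by linarith
  have hcx : 0 < c * (s * x) := by positivity
  have hW0 : 0 < W := hcx.trans_le hW
  have hmx : m / x ≤ 1 / m ^ 2 := by
    rw [div_le_div_iff₀ hx0 (by positivity)]
    nlinarith
  have h1 : E / W ^ 2 ≤ 2 * m / W + s ^ 2 * (x + (C' + 8 * m * V) / x) / W ^ 2 := by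
    have : 2 * m / W = 2 * m * W / W ^ 2 := by field_simp
    rw [this, ← add_div]
    exact div_le_div_of_nonneg_right hE (by positivity)
  have h2 : 2 * m / W ≤ 2 / c * (1 / m ^ 2) := by
    calc 2 * m / W ≤ 2 * m / (c * x) := by
          refine div_le_div_of_nonneg_left (by positivity) (by positivity) (le_trans ?_ hW)
          exact mul_le_mul_of_nonneg_left (le_mul_of_one_le_left hx0.le hs) hc.le
      _ = 2 / c * (m / x) := by field_simp
      _ ≤ _ := mul_le_mul_of_nonneg_left hmx (by positivity)
  have h3 : x + (C' + 8 * m * V) / x ≤ (1 + C' + 8 * C) * (m * x) := by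
    have h4 : (C' + 8 * m * V) / x ≤ (C' + 8 * m * (C * x ^ 2)) / x := by gcongr
    have h5 : (C' + 8 * m * (C * x ^ 2)) / x = C' / x + 8 * C * (m * x) := by field_simp
    have h6 : C' / x ≤ C' := div_le_self hC' hx1
    have h7 : x ≤ m * x := le_mul_of_one_le_left hx0.le hm
    have h8 : C' ≤ C' * (m * x) := le_mul_of_one_le_right hC' (hx1.trans h7)
    nlinarith
  have h4 : s ^ 2 * (x + (C' + 8 * m * V) / x) / W ^ 2 ≤
      (1 + C' + 8 * C) / c ^ 2 * (1 / m ^ 2) := by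
    calc s ^ 2 * (x + (C' + 8 * m * V) / x) / W ^ 2
        ≤ s ^ 2 * ((1 + C' + 8 * C) * (m * x)) / W ^ 2 := by gcongr
      _ ≤ s ^ 2 * ((1 + C' + 8 * C) * (m * x)) / (c * (s * x)) ^ 2 := by gcongr
      _ = (1 + C' + 8 * C) / c ^ 2 * (m / x) := by field_simp
      _ ≤ _ := mul_le_mul_of_nonneg_left hmx (by positivity)
  linarith

lemma exists_bound_pow_mul_half_pow (q : ℕ) :
    ∃ C : ℝ, 0 ≤ C ∧ ∀ n : ℕ, (n : ℝ) ^ q * (1 / 2) ^ n ≤ C := by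
  have h := tendsto_pow_const_mul_const_pow_of_abs_lt_one q (r := 1 / 2) (by norm_num [abs_lt])
  obtain ⟨C, hC⟩ := h.bddAbove_range
  exact ⟨C, le_trans (by positivity) (hC ⟨0, rfl⟩), fun n => hC ⟨n, rfl⟩⟩

end Rates

/-! ### The targets and their return times -/

section Threshold

variable {a b : ℝ}

/-- The right endpoint of the `n`-th shrinking target. -/
noncomputable def gaussThreshold (a b : ℝ) (n : ℕ) : ℝ := b ^ ((n : ℝ) ^ (-a)) - 1

lemma gaussMeasure_Ioo_gaussThreshold (hb : 1 < b) {n : ℕ} (h : b ^ ((n : ℝ) ^ (-a)) ≤ 2) :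
    gaussMeasure (Set.Ioo 0 (b ^ ((n : ℝ) ^ (-a)) - 1)) =
      ENNReal.ofReal (Real.log b / Real.log 2 * (n : ℝ) ^ (-a)) := by
  have h1 : 1 ≤ b ^ ((n : ℝ) ^ (-a)) :=
    Real.one_le_rpow hb.le (Real.rpow_nonneg n.cast_nonneg _)
  rw [gaussMeasure_Ioo (by linarith) (by linarith), add_sub_cancel,
    Real.log_rpow (by linarith)]
  congr 1
  ring

lemma log_div_log_two_pos (hb : 1 < b) : 0 < Real.log b / Real.log 2 :=
  div_pos (Real.log_pos hb) (Real.log_pos one_lt_two)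

/-- The measure of `(0, t)` is `log₂(1+t)`, capped at `1` once `t ≥ 1`. The formula includes `n =
0`, where both sides vanish because `0 ^ (-a) = 0` for `a ≠ 0`, and `a = 0` is covered as well. -/
lemma hitProb_gaussThreshold (hb : 1 < b) (n : ℕ) :
    hitProb (gaussThreshold a b) n = min 1 (Real.log b / Real.log 2 * (n : ℝ) ^ (-a)) := by
  have hlog : 0 < Real.log 2 := Real.log_pos one_lt_two
  have hn : 0 ≤ (n : ℝ) ^ (-a) := Real.rpow_nonneg n.cast_nonneg _
  have hκ := log_div_log_two_pos hb
  have hb0 : 0 < b := by linarith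
  rcases le_total (b ^ ((n : ℝ) ^ (-a))) 2 with h | h
  · rw [hitProb, gaussThreshold, Measure.real, gaussMeasure_Ioo_gaussThreshold hb h,
      ENNReal.toReal_ofReal (by positivity), min_eq_right]
    have h1 := Real.log_le_log (by positivity) h
    rw [Real.log_rpow hb0] at h1
    rw [div_mul_eq_mul_div, div_le_one hlog]
    linarith
  · have h1 : gaussMeasure (Set.Ioo 0 (gaussThreshold a b n)) = 1 := by
      rw [← measure_univ (μ := gaussMeasure)]
      refine measure_congr ?_
      filter_upwards [ae_gaussMeasure_mem_Ioo] with x hx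
      refine propext ⟨fun _ => trivial, fun _ => ⟨hx.1, ?_⟩⟩
      unfold gaussThreshold
      linarith [hx.2]
    rw [hitProb, Measure.real, h1, ENNReal.toReal_one, min_eq_left]
    have h1 := Real.log_le_log two_pos h
    rw [Real.log_rpow hb0] at h1
    rw [div_mul_eq_mul_div, one_le_div hlog]
    linarith

lemma hitProb_gaussThreshold_zero (ha : 0 < a) (hb : 1 < b) :
    hitProb (gaussThreshold a b) 0 = 0 := by
  rw [hitProb_gaussThreshold hb, Nat.cast_zero, Real.zero_rpow (by linarith), mul_zero]
  exact min_eq_right zero_le_one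

lemma hitProb_gaussThreshold_le_of_le (ha : 0 < a) (hb : 1 < b) {m n : ℕ} (hm : 1 ≤ m)
    (hmn : m ≤ n) : hitProb (gaussThreshold a b) n ≤ hitProb (gaussThreshold a b) m := by
  rw [hitProb_gaussThreshold hb, hitProb_gaussThreshold hb]
  refine min_le_min le_rfl (mul_le_mul_of_nonneg_left ?_ (log_div_log_two_pos hb).le)
  exact Real.rpow_le_rpow_of_nonpos (by exact_mod_cast hm) (by exact_mod_cast hmn) (by linarith)

lemma hitProb_gaussThreshold_mul_le (ha : 0 < a) (hb : 1 < b) (n h : ℕ) :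
    hitProb (gaussThreshold a b) n * hitProb (gaussThreshold a b) (n + h) ≤
      hitProb (gaussThreshold a b) n ^ 2 := by
  rcases Nat.eq_zero_or_pos n with rfl | hn
  · rw [hitProb_gaussThreshold_zero ha hb]
    simp
  · rw [sq]
    exact mul_le_mul_of_nonneg_left (hitProb_gaussThreshold_le_of_le ha hb hn (by omega))
      (hitProb_nonneg _ _)

/-- Each term with `1 ≤ n < N` is at least `min 1 κ · N^(-a)`, there are `N - 1 ≥ N/2` of them, and
`√N · N^(1/2-a) = N^(1-a)`. -/
lemma exists_le_sum_hitProb (ha : 0 < a) (hb : 1 < b) : ∃ c : ℝ, 0 < c ∧ ∀ N : ℕ, 2 ≤ N →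
    c * (Real.sqrt N * (N : ℝ) ^ (1 / 2 - a)) ≤
      ∑ n ∈ Finset.range N, hitProb (gaussThreshold a b) n := by
  set κ := Real.log b / Real.log 2 with hκ
  have hκ0 : 0 < κ := log_div_log_two_pos hb
  have hmin : 0 < min 1 κ := lt_min one_pos hκ0
  refine ⟨min 1 κ / 2, by positivity, fun N hN => ?_⟩
  have hN' : (2 : ℝ) ≤ N := by exact_mod_cast hN
  have hN0 : (0 : ℝ) < N := by linarith
  have h1 : ∀ n ∈ Finset.Ico 1 N, min 1 κ * (N : ℝ) ^ (-a) ≤ hitProb (gaussThreshold a b) n := by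
    intro n hn
    rw [Finset.mem_Ico] at hn
    refine le_trans ?_ (hitProb_gaussThreshold_le_of_le ha hb hn.1 hn.2.le)
    have h2 : (N : ℝ) ^ (-a) ≤ 1 := Real.rpow_le_one_of_one_le_of_nonpos (by linarith) (by linarith)
    have h3 : 0 ≤ (N : ℝ) ^ (-a) := Real.rpow_nonneg hN0.le _
    rw [hitProb_gaussThreshold hb]
    exact le_min (mul_le_one₀ (min_le_left _ _) h3 h2)
      (mul_le_mul_of_nonneg_right (min_le_right _ _) h3)
  have h2 := Finset.card_nsmul_le_sum _ _ _ h1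
  rw [Nat.card_Ico, nsmul_eq_mul, Nat.cast_sub (by omega)] at h2
  have h3 : Real.sqrt N * (N : ℝ) ^ (1 / 2 - a) = N * (N : ℝ) ^ (-a) := by
    rw [Real.sqrt_eq_rpow, ← Real.rpow_add hN0]
    rw [show (1 / 2 : ℝ) + (1 / 2 - a) = 1 + -a by ring, Real.rpow_add hN0, Real.rpow_one]
  rw [h3, Finset.range_eq_Ico, Finset.sum_eq_sum_Ico_succ_bot (by omega),
    hitProb_gaussThreshold_zero ha hb, zero_add]
  refine le_trans ?_ h2
  have h4 : 0 ≤ min 1 κ * (N : ℝ) ^ (-a) := mul_nonneg hmin.le (Real.rpow_nonneg hN0.le _)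
  push_cast
  nlinarith

/-- The squares are at most `κ² n^(-2a)`; `2a < 1` makes their sum of order `N^(1-2a)`. -/
lemma exists_sum_sq_hitProb_le (ha : 0 < a) (ha' : a < 1 / 2) (hb : 1 < b) :
    ∃ C : ℝ, 0 ≤ C ∧ ∀ N : ℕ,
      ∑ n ∈ Finset.range N, hitProb (gaussThreshold a b) n ^ 2 ≤
        C * ((N : ℝ) ^ (1 / 2 - a)) ^ 2 := by
  set κ := Real.log b / Real.log 2 with hκ
  have hκ0 : 0 < κ := log_div_log_two_pos hb
  have h2a : 0 < 1 - 2 * a := by linarith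
  refine ⟨κ ^ 2 / (1 - 2 * a), by positivity, fun N => ?_⟩
  have h1 : ∀ n ∈ Finset.range N, hitProb (gaussThreshold a b) n ^ 2 ≤
      κ ^ 2 * (n : ℝ) ^ (-(2 * a)) := by
    intro n _
    have h2 : hitProb (gaussThreshold a b) n ≤ κ * (n : ℝ) ^ (-a) := by
      rw [hitProb_gaussThreshold hb]
      exact min_le_right _ _
    refine (pow_le_pow_left₀ (hitProb_nonneg _ _) h2 2).trans (le_of_eq ?_)
    rw [mul_pow, ← Real.rpow_mul_natCast n.cast_nonneg]
    congr 2
    push_cast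
    ring
  refine (Finset.sum_le_sum h1).trans ?_
  rw [← Finset.mul_sum, ← Real.rpow_mul_natCast N.cast_nonneg,
    show (1 / 2 - a) * ((2 : ℕ) : ℝ) = 1 - 2 * a by push_cast; ring, div_mul_eq_mul_div,
    mul_div_assoc]
  exact mul_le_mul_of_nonneg_left (sum_rpow_neg_le (by linarith) (by linarith) N) (by positivity)

lemma tendsto_sum_hitProb (ha : 0 < a) (ha' : a < 1 / 2) (hb : 1 < b) :
    Tendsto (fun N : ℕ => ∑ n ∈ Finset.range N, hitProb (gaussThreshold a b) n) atTop atTop := by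
  obtain ⟨c, hc, hW⟩ := exists_le_sum_hitProb ha hb
  have h1 : Tendsto (fun N : ℕ => c * Real.sqrt (N : ℝ)) atTop atTop :=
    (Real.tendsto_sqrt_atTop.comp tendsto_natCast_atTop_atTop).const_mul_atTop hc
  refine tendsto_atTop_mono' _ ?_ h1
  filter_upwards [eventually_ge_atTop 2] with N hN
  refine le_trans ?_ (hW N hN)
  have hN' : (1 : ℝ) ≤ N := by exact_mod_cast (by omega : 1 ≤ N)
  exact mul_le_mul_of_nonneg_left (le_mul_of_one_le_right (Real.sqrt_nonneg _)
    (Real.one_le_rpow hN' (by linarith))) hc.le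

lemma indicator_gaussReturnTimes_sub (ha : 0 < a) (y : ℝ) :
    (fun n => (gaussReturnTimes a b y).indicator (1 : ℕ → ℝ) n - hitProb (gaussThreshold a b) n) =
      fun n => centredHit (gaussThreshold a b) n y := by
  funext n
  rw [centredHit, centredIndicator, hitProb]
  congr 1
  by_cases h : gaussMap^[n] y ∈ Set.Ioo 0 (gaussThreshold a b n)
  · have hn : 1 ≤ n := by
      by_contra hn
      -- At `n = 0` the threshold is `b^0 - 1 = 0`, so the target is empty, in accordance with the
      -- condition `1 ≤ n`.
      obtain rfl : n = 0 := by omega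
      have h1 : gaussThreshold a b 0 = 0 := by
        rw [gaussThreshold, Nat.cast_zero, Real.zero_rpow (by linarith), Real.rpow_zero, sub_self]
      rw [h1] at h
      exact absurd (h.1.trans h.2) (lt_irrefl _)
    rw [Set.indicator_of_mem h, Set.indicator_of_mem (show n ∈ gaussReturnTimes a b y from ⟨hn, h⟩)]
    rfl
  · rw [Set.indicator_of_notMem h,
      Set.indicator_of_notMem (show n ∉ gaussReturnTimes a b y from fun h1 => h h1.2)]

lemma tendsto_ratio_pow (p : ℕ) : Tendsto (fun k : ℕ =>
    (((k + 1 + 2) ^ p : ℕ) : ℝ) / ((k + 2) ^ p : ℕ)) atTop (𝓝 1) := by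
  have h1 : Tendsto (fun k : ℕ => 1 + 1 / (((k + 2 : ℕ) : ℝ))) atTop (𝓝 (1 + 0)) :=
    tendsto_const_nhds.add (tendsto_one_div_atTop_nhds_zero_nat.comp (tendsto_add_atTop_nat 2))
  have h2 := h1.pow p
  rw [add_zero, one_pow] at h2
  refine h2.congr fun k => ?_
  push_cast
  rw [← div_pow]
  congr 1
  have : (k : ℝ) + 2 ≠ 0 := by positivity
  field_simp
  ring

/-- For almost every `y`, the return times have the expected density. -/
theorem ae_hasRegularDensity (ha : 0 < a) (ha' : a < 1 / 2) (hb : 1 < b) :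
    ∃ N : ℕ → ℕ, ∀ᵐ y ∂gaussMeasure,
      HasRegularDensity (gaussReturnTimes a b y) (hitProb (gaussThreshold a b)) N := by
  -- This choice gives `(N k)^(1/2-a) ≥ (k+2)³`. Polynomial growth of `N` keeps consecutive ratios
  -- tending to `1` and lets `2^(-(k+2))` absorb `(N k)²`.
  obtain ⟨p, hp⟩ := exists_nat_ge (3 / (1 / 2 - a))
  have hδ : 0 < 1 / 2 - a := by linarith
  rw [div_le_iff₀ hδ] at hp
  have hp0 : p ≠ 0 := by
    rintro rfl
    norm_num at hp
  set N : ℕ → ℕ := fun k => (k + 2) ^ p with hN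
  set t := gaussThreshold a b with ht
  set W : ℕ → ℝ := fun M => ∑ n ∈ Finset.range M, hitProb t n with hW
  have hN2 : ∀ k, 2 ≤ N k := fun k =>
    (show 2 ≤ k + 2 by omega).trans (Nat.le_self_pow hp0 _)
  have hNmono : StrictMono N := fun i j hij => Nat.pow_lt_pow_left (by omega) hp0
  obtain ⟨c, hc, hWc⟩ := exists_le_sum_hitProb ha hb
  obtain ⟨C, hC, hVC⟩ := exists_sum_sq_hitProb_le ha ha' hb
  obtain ⟨C', hC', hCC'⟩ := exists_bound_pow_mul_half_pow (2 * p)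
  have hanti : Antitone fun n => hitProb t (n + 1) := fun m n hmn =>
    hitProb_gaussThreshold_le_of_le ha hb (by omega) (by omega)
  have hN1 : ∀ k, (1 : ℝ) ≤ N k := fun k => by exact_mod_cast (by linarith [hN2 k] : 1 ≤ N k)
  have hWpos : ∀ k, 0 < W (N k) := fun k => by
    refine lt_of_lt_of_le ?_ (hWc (N k) (hN2 k))
    have := hN1 k
    positivity
  have hint := integrable_autocorrelationSum t
  have hrate : ∀ k : ℕ, ∫ y, autocorrelationSum (fun n => centredHit t n y) (N k) / W (N k) ^ 2
      ∂gaussMeasure ≤ (2 / c + (1 + C' + 8 * C) / c ^ 2) * (1 / ((k + 2 : ℕ) : ℝ) ^ 2) := by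
    intro k
    have hk : (1 : ℝ) ≤ ((k + 2 : ℕ) : ℝ) := by exact_mod_cast (by omega : 1 ≤ k + 2)
    have hx : ((k + 2 : ℕ) : ℝ) ^ 3 ≤ (N k : ℝ) ^ (1 / 2 - a) := by
      have h1 : (N k : ℝ) = ((k + 2 : ℕ) : ℝ) ^ (p : ℝ) := by
        rw [Real.rpow_natCast, hN]
        push_cast
        rfl
      rw [h1, ← Real.rpow_mul (by linarith), ← Real.rpow_natCast]
      exact Real.rpow_le_rpow_of_exponent_le hk (by exact_mod_cast hp)
    have hx0 : 0 < (N k : ℝ) ^ (1 / 2 - a) := Real.rpow_pos_of_pos (by linarith [hN1 k]) _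
    rw [integral_div]
    refine div_sq_le_of_rate (s := Real.sqrt (N k)) hk hx (Real.one_le_sqrt.2 (hN1 k)) hc hC hC'
      (hWc _ (hN2 k)) (hVC (N k)) ?_
    -- The gap is `L = k + 2`, logarithmically too generous but harmless, and `x = (N k)^(1/2-a)`.
    refine (integral_autocorrelationSum_le t (hitProb_gaussThreshold_mul_le ha hb) (N k) (k + 2)
      hx0).trans ?_
    rw [Real.sq_sqrt (by linarith [hN1 k])]
    have h2 : (N k : ℝ) ^ 2 * (1 / 2) ^ (k + 2) ≤ C' := by
      have := hCC' (k + 2)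
      rwa [mul_comm 2 p, pow_mul, ← Nat.cast_pow] at this
    have := hN1 k
    gcongr
  have hsum : Summable fun k : ℕ =>
      (2 / c + (1 + C' + 8 * C) / c ^ 2) * (1 / ((k + 2 : ℕ) : ℝ) ^ 2) :=
    ((summable_nat_add_iff 2).2 (Real.summable_one_div_nat_pow.2 one_lt_two)).mul_left _
  have hae := ae_summable_of_summable_integral (μ := gaussMeasure)
    (F := fun k y => autocorrelationSum (fun n => centredHit t n y) (N k) / W (N k) ^ 2)
    (fun k => (hint (N k)).div_const _)
    (fun k y => div_nonneg (autocorrelationSum_nonneg _ _) (sq_nonneg _))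
    (Summable.of_nonneg_of_le (fun k => integral_nonneg fun y =>
      div_nonneg (autocorrelationSum_nonneg _ _) (sq_nonneg _)) hrate hsum)
  refine ⟨N, hae.mono fun y hy => ?_⟩
  exact
    { zero := hitProb_gaussThreshold_zero ha hb
      nonneg := hitProb_nonneg t
      antitone := hanti
      tendsto_sum := tendsto_sum_hitProb ha ha' hb
      strictMono := hNmono
      sum_pos := hWpos
      tendsto_ratio := by
        have h1 : Tendsto (fun k => 1 + 2 * ((N (k + 1) : ℝ) / N k - 1)) atTop
            (𝓝 (1 + 2 * (1 - 1))) :=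
          (((tendsto_ratio_pow p).sub_const 1).const_mul 2).const_add 1
        rw [sub_self, mul_zero, add_zero] at h1
        refine tendsto_of_tendsto_of_tendsto_of_le_of_le tendsto_const_nhds h1 (fun k => ?_)
          fun k => ?_
        · rw [one_le_div (hWpos k)]
          exact Finset.sum_le_sum_of_subset_of_nonneg
            (Finset.range_mono (hNmono.monotone k.le_succ)) fun n _ _ => hitProb_nonneg t n
        · have := ratio_sum_sub_one_le (hitProb_nonneg t) hanti (hN2 k)
            (hNmono.monotone k.le_succ) (hWpos k)
          simp only
          linarith
      summable := by
        rw [indicator_gaussReturnTimes_sub ha y]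
        exact hy }

lemma eventually_rpow_rpow_neg_le_two (ha : 0 < a) (hb : 1 < b) :
    ∀ᶠ n : ℕ in atTop, b ^ ((n : ℝ) ^ (-a)) ≤ 2 := by
  have h1 : Tendsto (fun n : ℕ => (n : ℝ) ^ (-a)) atTop (𝓝 0) :=
    (tendsto_rpow_neg_atTop ha).comp tendsto_natCast_atTop_atTop
  have h2 := ((Real.continuous_const_rpow (show b ≠ 0 by linarith)).tendsto 0).comp h1
  rw [Real.rpow_zero] at h2
  filter_upwards [h2.eventually_lt_const one_lt_two] with n hn
  exact hn.le

end Threshold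

theorem corollaryB (a b : ℝ) (ha : 0 < a) (ha' : a < 1 / 2) (hb : 1 < b) :
    (∀ᵐ y ∂(volume.restrict (Set.Ico (0 : ℝ) 1)),
      (gaussReturnTimes a b y).Infinite ∧
      PointwiseUniversallyGood.{u} 2 (Nat.nth (fun n => n ∈ gaussReturnTimes a b y)) ∧
      IsErgodicSequence.{u} (Nat.nth (fun n => n ∈ gaussReturnTimes a b y))) ∧
    (∀ n : ℕ, 1 ≤ n → b ^ ((n : ℝ) ^ (-a)) ≤ 2 →
      gaussMeasure (Set.Ioo (0 : ℝ) (b ^ ((n : ℝ) ^ (-a)) - 1)) =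
        ENNReal.ofReal (Real.log b / Real.log 2 * (n : ℝ) ^ (-a))) ∧
    (∀ᶠ n : ℕ in atTop, b ^ ((n : ℝ) ^ (-a)) ≤ 2) := by
  obtain ⟨N, hN⟩ := ae_hasRegularDensity ha ha' hb
  refine ⟨?_, fun n _ h => gaussMeasure_Ioo_gaussThreshold hb h,
    eventually_rpow_rpow_neg_le_two ha hb⟩
  -- The Gauss density is positive on `[0, 1)`, so Gauss-null sets are Lebesgue-null there.
  filter_upwards [ae_volume_of_ae_gaussMeasure hN] with y hy
  exact ⟨hy.infinite, hy.pointwiseUniversallyGood, hy.isErgodicSequence⟩
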